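/- **Theorem.** Let $\Omega\subset\mathbb R^2$ be (the interior of) a triangle with interior angles $\pi/6,\pi/3,\pi/2$ and hypotenuse of length $\ell>0$. Call a real number $\lambda$ a Dirichlet (respectively Neumann) eigenvalue of $\Omega$ if there is a non-zero function $u\in H^2(\Omega)$ with $\Delta u+\lambda u=0$ in $\Omega$ and $u=0$ (respectively $\partial u/\partial n=0$) on $\partial\Omega$; its multiplicity is the dimension of the space of all such $u$. All multiplicities are finite, and for every $t>0$ the heat traces $$H^D(t)=\sum_{\lambda}e^{-\lambda t},\qquad H^N(t)=\sum_{\mu}e^{-\mu t},$$ where $\lambda$ runs over the Dirichlet and $\mu$ over the Neumann eigenvalues of $\Omega$, counted with multiplicity, converge. As $t\to0^+$, $$H^D(t)=\frac{\ell^2\sqrt3}{32\pi t}-\frac{\ell(3+\sqrt3)}{16\sqrt{\pi t}}+\frac5{12}-\frac{\ell}{8}\sqrt{\frac{3}{\pi t}}\,e^{-\frac{3\ell^2}{16t}}-\frac{3\ell}{8\sqrt{\pi t}}\,e^{-\frac{9\ell^2}{16t}}+R^D(t),$$ $$H^N(t)=\frac{\ell^2\sqrt3}{32\pi t}+\frac{\ell(3+\sqrt3)}{16\sqrt{\pi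 t}}+\frac5{12}+\frac{\ell}{8}\sqrt{\frac{3}{\pi t}}\,e^{-\frac{3\ell^2}{16t}}+\frac{3\ell}{8\sqrt{\pi t}}\,e^{-\frac{9\ell^2}{16t}}+R^N(t),$$ where $R^D(t)$ and $R^N(t)$ are $\mathcal O\!\left(t^{-1}e^{-\frac{3\ell^2}{4t}}\right)$. These remainder estimates are sharp: for $R=R^D$ and for $R=R^N$, also $t^{-1}e^{-\frac{3\ell^2}{4t}}=\mathcal O(R(t))$ as $t\to0^+$, and $\frac{3\ell^2}{4}$ is the supremum of all $c>0$ such that $R(t)=\mathcal O(e^{-c/t})$ as $t\to0^+$. -/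

import Mathlib

open MeasureTheory Filter Topology TopologicalSpace EuclideanGeometry Asymptotics
open scoped Distributions ENNReal

/-- The Euclidean plane. -/
abbrev Plane : Type := EuclideanSpace ℝ (Fin 2)

/-- Real-valued square integrable functions on the open set `Ω`. -/
abbrev L2 (Ω : Opens Plane) : Type := Lp ℝ 2 (volume.restrict (Ω : Set Plane))

/-- The classical partial derivative `∂ᵢ φ`. -/
noncomputable def partialDeriv (i : Fin 2) (φ : Plane → ℝ) (x : Plane) : ℝ :=
  fderiv ℝ φ x (EuclideanSpace.single i 1)

/-- `w` is the weak partial derivative `∂ᵢ u` on `Ω`. -/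
def HasWeakPartial (Ω : Opens Plane) (i : Fin 2) (u w : L2 Ω) : Prop :=
  ∀ φ : 𝓓(Ω, ℝ),
    ∫ x in (Ω : Set Plane), u x * partialDeriv i φ x = -∫ x in (Ω : Set Plane), w x * φ x

/-- `u ∈ H¹(Ω)` with weak gradient `g`. -/
def HasWeakGradient (Ω : Opens Plane) (u : L2 Ω) (g : Fin 2 → L2 Ω) : Prop :=
  ∀ i, HasWeakPartial Ω i u (g i)

/-- `u ∈ H²(Ω)` with weak gradient `g` and weak Hessian `h`, and `Δu + lam u = 0` in `Ω`. -/
structure SolvesHelmholtz (Ω : Opens Plane) (lam : ℝ) (u : L2 Ω)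
    (g : Fin 2 → L2 Ω) (h : Fin 2 → Fin 2 → L2 Ω) : Prop where
  gradient : HasWeakGradient Ω u g
  hessian : ∀ i, HasWeakGradient Ω (g i) (h i)
  helmholtz : (∑ i, h i i) + lam • u = 0

/-- The Dirichlet boundary condition `u = 0` on `∂Ω` for `u` with gradient `g`, in the sense of
`H¹₀(Ω)`: `u` is a limit, in the `H¹` norm, of smooth functions with compact support in `Ω`. -/
def DirichletCondition (Ω : Opens Plane) (u : L2 Ω) (g : Fin 2 → L2 Ω) : Prop :=
  ∃ φ : ℕ → 𝓓(Ω, ℝ),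
    Tendsto (fun n ↦ eLpNorm (fun x ↦ u x - φ n x) 2 (volume.restrict (Ω : Set Plane)))
      atTop (𝓝 0) ∧
    ∀ i, Tendsto (fun n ↦ eLpNorm (fun x ↦ g i x - partialDeriv i (φ n) x) 2
      (volume.restrict (Ω : Set Plane))) atTop (𝓝 0)

/-- The Neumann boundary condition `∂u/∂n = 0` on `∂Ω`, for a function in `H²(Ω)` with gradient
`g` and Hessian `h`: the boundary term `∫_∂Ω (∂u/∂n) v` of Green's formula, that is
`∫_Ω ∇u · ∇v + ∫_Ω (Δu) v`, vanishes for every `v ∈ H¹(Ω)`. -/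
def NeumannCondition (Ω : Opens Plane) (g : Fin 2 → L2 Ω) (h : Fin 2 → Fin 2 → L2 Ω) : Prop :=
  ∀ (v : L2 Ω) (dv : Fin 2 → L2 Ω), HasWeakGradient Ω v dv →
    (∑ i, inner ℝ (g i) (dv i)) + inner ℝ (∑ i, h i i) v = 0

/-! Linearity of these notions, needed for the eigenspaces to be subspaces. -/

theorem partialDeriv_continuous {Ω : Opens Plane} (i : Fin 2) (φ : 𝓓(Ω, ℝ)) :
    Continuous (partialDeriv i φ) :=
  (φ.contDiff.continuous_fderiv (by simp)).clm_apply continuous_const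

theorem partialDeriv_memLp {Ω : Opens Plane} (i : Fin 2) (φ : 𝓓(Ω, ℝ)) :
    MemLp (partialDeriv i φ) 2 (volume.restrict (Ω : Set Plane)) :=
  ((partialDeriv_continuous i φ).memLp_of_hasCompactSupport
    (φ.hasCompactSupport.fderiv_apply ℝ _)).restrict _

theorem testFunction_memLp {Ω : Opens Plane} (φ : 𝓓(Ω, ℝ)) :
    MemLp φ 2 (volume.restrict (Ω : Set Plane)) :=
  (φ.continuous.memLp_of_hasCompactSupport φ.hasCompactSupport).restrict _

theorem partialDeriv_add {Ω : Opens Plane} (i : Fin 2) (φ ψ : 𝓓(Ω, ℝ)) (x : Plane) :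
    partialDeriv i (φ + ψ : 𝓓(Ω, ℝ)) x = partialDeriv i φ x + partialDeriv i ψ x := by
  have h : ((φ + ψ : 𝓓(Ω, ℝ)) : Plane → ℝ) = (φ : Plane → ℝ) + ψ := rfl
  have h1 := (φ.contDiff.differentiable (by simp)) x
  have h2 := (ψ.contDiff.differentiable (by simp)) x
  simp [partialDeriv, h, fderiv_add h1 h2]

theorem partialDeriv_smul {Ω : Opens Plane} (i : Fin 2) (c : ℝ) (φ : 𝓓(Ω, ℝ)) (x : Plane) :
    partialDeriv i (c • φ : 𝓓(Ω, ℝ)) x = c * partialDeriv i φ x := by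
  have h : ((c • φ : 𝓓(Ω, ℝ)) : Plane → ℝ) = c • (φ : Plane → ℝ) := rfl
  have h1 := (φ.contDiff.differentiable (by simp)) x
  simp [partialDeriv, h, fderiv_const_smul h1]

theorem integral_add_mul {Ω : Opens Plane} (u v : L2 Ω) {f : Plane → ℝ}
    (hf : MemLp f 2 (volume.restrict (Ω : Set Plane))) :
    ∫ x in (Ω : Set Plane), (u + v : L2 Ω) x * f x =
      (∫ x in (Ω : Set Plane), u x * f x) + ∫ x in (Ω : Set Plane), v x * f x := by
  have hu : Integrable (fun x ↦ u x * f x) (volume.restrict (Ω : Set Plane)) :=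
    (Lp.memLp u).integrable_mul hf
  have hv : Integrable (fun x ↦ v x * f x) (volume.restrict (Ω : Set Plane)) :=
    (Lp.memLp v).integrable_mul hf
  rw [← integral_add hu hv]
  refine integral_congr_ae ?_
  filter_upwards [Lp.coeFn_add u v] with x hx
  rw [hx, Pi.add_apply, add_mul]

theorem integral_smul_mul {Ω : Opens Plane} (c : ℝ) (u : L2 Ω) (f : Plane → ℝ) :
    ∫ x in (Ω : Set Plane), (c • u : L2 Ω) x * f x =
      c * ∫ x in (Ω : Set Plane), u x * f x := by
  rw [← integral_const_mul]
  refine integral_congr_ae ?_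
  filter_upwards [Lp.coeFn_smul c u] with x hx
  simp [hx, mul_assoc]

theorem HasWeakPartial.add {Ω : Opens Plane} {i : Fin 2} {u w u' w' : L2 Ω}
    (h : HasWeakPartial Ω i u w) (h' : HasWeakPartial Ω i u' w') :
    HasWeakPartial Ω i (u + u') (w + w') := fun φ ↦ by
  rw [integral_add_mul u u' (partialDeriv_memLp i φ), integral_add_mul w w' (testFunction_memLp φ),
    h φ, h' φ]
  ring

theorem HasWeakPartial.smul {Ω : Opens Plane} {i : Fin 2} {u w : L2 Ω} (c : ℝ)
    (h : HasWeakPartial Ω i u w) : HasWeakPartial Ω i (c • u) (c • w) := fun φ ↦ by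
  rw [integral_smul_mul, integral_smul_mul, h φ]
  ring

theorem SolvesHelmholtz.add {Ω : Opens Plane} {lam : ℝ} {u u' : L2 Ω} {g g' : Fin 2 → L2 Ω}
    {h h' : Fin 2 → Fin 2 → L2 Ω} (H : SolvesHelmholtz Ω lam u g h)
    (H' : SolvesHelmholtz Ω lam u' g' h') :
    SolvesHelmholtz Ω lam (u + u') (g + g') (h + h') where
  gradient i := (H.gradient i).add (H'.gradient i)
  hessian i j := (H.hessian i j).add (H'.hessian i j)
  helmholtz := by
    have e : (∑ i, (h + h') i i) + lam • (u + u') =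
        ((∑ i, h i i) + lam • u) + ((∑ i, h' i i) + lam • u') := by
      simp only [Pi.add_apply, Finset.sum_add_distrib, smul_add]
      abel
    rw [e, H.helmholtz, H'.helmholtz, add_zero]

theorem SolvesHelmholtz.smul {Ω : Opens Plane} {lam : ℝ} {u : L2 Ω} {g : Fin 2 → L2 Ω}
    {h : Fin 2 → Fin 2 → L2 Ω} (c : ℝ) (H : SolvesHelmholtz Ω lam u g h) :
    SolvesHelmholtz Ω lam (c • u) (c • g) (c • h) where
  gradient i := (H.gradient i).smul c
  hessian i j := (H.hessian i j).smul c
  helmholtz := by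
    have e : (∑ i, (c • h) i i) + lam • c • u = c • ((∑ i, h i i) + lam • u) := by
      simp only [Pi.smul_apply, smul_add, Finset.smul_sum, smul_comm lam c]
    rw [e, H.helmholtz, smul_zero]

theorem tendsto_eLpNorm_add {Ω : Opens Plane} {u u' : L2 Ω} {f f' : ℕ → Plane → ℝ}
    (hf : ∀ n, MemLp (f n) 2 (volume.restrict (Ω : Set Plane)))
    (hf' : ∀ n, MemLp (f' n) 2 (volume.restrict (Ω : Set Plane)))
    (h : Tendsto (fun n ↦ eLpNorm (fun x ↦ u x - f n x) 2 (volume.restrict (Ω : Set Plane)))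
      atTop (𝓝 0))
    (h' : Tendsto (fun n ↦ eLpNorm (fun x ↦ u' x - f' n x) 2 (volume.restrict (Ω : Set Plane)))
      atTop (𝓝 0)) :
    Tendsto (fun n ↦ eLpNorm (fun x ↦ (u + u' : L2 Ω) x - (f n x + f' n x)) 2
      (volume.restrict (Ω : Set Plane))) atTop (𝓝 0) := by
  have hs := h.add h'
  rw [add_zero] at hs
  refine tendsto_of_tendsto_of_tendsto_of_le_of_le tendsto_const_nhds hs (fun _ ↦ bot_le) ?_
  intro n
  refine le_trans (le_of_eq (eLpNorm_congr_ae ?_))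
    (eLpNorm_add_le ((Lp.aestronglyMeasurable u).sub (hf n).1)
      ((Lp.aestronglyMeasurable u').sub (hf' n).1) (by norm_num))
  filter_upwards [Lp.coeFn_add u u'] with x hx
  simp only [hx, Pi.add_apply]
  ring

theorem tendsto_eLpNorm_smul {Ω : Opens Plane} {u : L2 Ω} {f : ℕ → Plane → ℝ} (c : ℝ)
    (h : Tendsto (fun n ↦ eLpNorm (fun x ↦ u x - f n x) 2 (volume.restrict (Ω : Set Plane)))
      atTop (𝓝 0)) :
    Tendsto (fun n ↦ eLpNorm (fun x ↦ (c • u : L2 Ω) x - c * f n x) 2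
      (volume.restrict (Ω : Set Plane))) atTop (𝓝 0) := by
  have hs := ENNReal.Tendsto.const_mul (a := ‖c‖ₑ) h (Or.inr enorm_ne_top)
  rw [mul_zero] at hs
  refine hs.congr fun n ↦ ?_
  rw [← eLpNorm_const_smul]
  refine eLpNorm_congr_ae ?_
  filter_upwards [Lp.coeFn_smul c u] with x hx
  simp only [hx, Pi.smul_apply, smul_eq_mul]
  ring

theorem DirichletCondition.add {Ω : Opens Plane} {u u' : L2 Ω} {g g' : Fin 2 → L2 Ω}
    (h : DirichletCondition Ω u g) (h' : DirichletCondition Ω u' g') :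
    DirichletCondition Ω (u + u') (g + g') := by
  obtain ⟨φ, h1, h2⟩ := h
  obtain ⟨ψ, h1', h2'⟩ := h'
  refine ⟨fun n ↦ φ n + ψ n, ?_, fun i ↦ ?_⟩
  · exact tendsto_eLpNorm_add (fun n ↦ testFunction_memLp (φ n))
      (fun n ↦ testFunction_memLp (ψ n)) h1 h1'
  · simp only [partialDeriv_add]
    exact tendsto_eLpNorm_add (fun n ↦ partialDeriv_memLp i (φ n))
      (fun n ↦ partialDeriv_memLp i (ψ n)) (h2 i) (h2' i)

theorem DirichletCondition.smul {Ω : Opens Plane} {u : L2 Ω} {g : Fin 2 → L2 Ω} (c : ℝ)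
    (h : DirichletCondition Ω u g) : DirichletCondition Ω (c • u) (c • g) := by
  obtain ⟨φ, h1, h2⟩ := h
  refine ⟨fun n ↦ c • φ n, tendsto_eLpNorm_smul c h1, fun i ↦ ?_⟩
  simp only [partialDeriv_smul]
  exact tendsto_eLpNorm_smul c (h2 i)

theorem NeumannCondition.add {Ω : Opens Plane} {g g' : Fin 2 → L2 Ω}
    {h h' : Fin 2 → Fin 2 → L2 Ω} (H : NeumannCondition Ω g h) (H' : NeumannCondition Ω g' h') :
    NeumannCondition Ω (g + g') (h + h') := fun v dv hv ↦ by
  have e := H v dv hv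
  have e' := H' v dv hv
  simp only [Pi.add_apply, inner_add_left, Finset.sum_add_distrib] at e e' ⊢
  linarith

theorem NeumannCondition.smul {Ω : Opens Plane} {g : Fin 2 → L2 Ω}
    {h : Fin 2 → Fin 2 → L2 Ω} (c : ℝ) (H : NeumannCondition Ω g h) :
    NeumannCondition Ω (c • g) (c • h) := fun v dv hv ↦ by
  have e := H v dv hv
  simp only [Pi.smul_apply, ← Finset.smul_sum, real_inner_smul_left, ← Finset.mul_sum]
  rw [← mul_add, e, mul_zero]

theorem hasWeakPartial_zero (Ω : Opens Plane) (i : Fin 2) : HasWeakPartial Ω i 0 0 := fun φ ↦ by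
  have h : ∀ f : Plane → ℝ, ∫ x in (Ω : Set Plane), (0 : L2 Ω) x * f x = 0 := fun f ↦ by
    simpa using integral_smul_mul (0 : ℝ) (0 : L2 Ω) f
  rw [h, h, neg_zero]

theorem solvesHelmholtz_zero (Ω : Opens Plane) (lam : ℝ) : SolvesHelmholtz Ω lam 0 0 0 where
  gradient i := hasWeakPartial_zero Ω i
  hessian _ j := hasWeakPartial_zero Ω j
  helmholtz := by simp

theorem dirichletCondition_zero (Ω : Opens Plane) : DirichletCondition Ω 0 0 := by
  have h0 (f : Plane → ℝ) (hf : ∀ x, f x = 0) :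
      eLpNorm (fun x ↦ (0 : L2 Ω) x - f x) 2 (volume.restrict (Ω : Set Plane)) = 0 := by
    rw [← eLpNorm_zero (ε := ℝ) (p := 2) (μ := volume.restrict (Ω : Set Plane))]
    refine eLpNorm_congr_ae ?_
    filter_upwards [Lp.coeFn_zero ℝ 2 (volume.restrict (Ω : Set Plane))] with x hx
    rw [hx, hf]
    simp
  have hp (i : Fin 2) (x : Plane) : partialDeriv i (0 : 𝓓(Ω, ℝ)) x = 0 := by
    have h := partialDeriv_smul i (0 : ℝ) (0 : 𝓓(Ω, ℝ)) x
    rwa [zero_smul, zero_mul] at h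
  exact ⟨fun _ ↦ 0, tendsto_const_nhds.congr fun _ ↦ (h0 _ fun _ ↦ rfl).symm,
    fun i ↦ tendsto_const_nhds.congr fun _ ↦ (h0 _ (hp i)).symm⟩

/-- The space of `u ∈ H²(Ω)` with `Δu + lam u = 0` in `Ω` and `u = 0` on `∂Ω`. -/
noncomputable def dirichletEigenspace (Ω : Opens Plane) (lam : ℝ) : Submodule ℝ (L2 Ω) where
  carrier := {u | ∃ g h, SolvesHelmholtz Ω lam u g h ∧ DirichletCondition Ω u g}
  zero_mem' := ⟨0, 0, solvesHelmholtz_zero Ω lam, dirichletCondition_zero Ω⟩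
  add_mem' := by
    rintro u u' ⟨g, h, H, D⟩ ⟨g', h', H', D'⟩
    exact ⟨g + g', h + h', H.add H', D.add D'⟩
  smul_mem' := by
    rintro c u ⟨g, h, H, D⟩
    exact ⟨c • g, c • h, H.smul c, D.smul c⟩

/-- The space of `u ∈ H²(Ω)` with `Δu + lam u = 0` in `Ω` and `∂u/∂n = 0` on `∂Ω`. -/
noncomputable def neumannEigenspace (Ω : Opens Plane) (lam : ℝ) : Submodule ℝ (L2 Ω) where
  carrier := {u | ∃ g h, SolvesHelmholtz Ω lam u g h ∧ NeumannCondition Ω g h}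
  zero_mem' := ⟨0, 0, solvesHelmholtz_zero Ω lam, fun _ _ _ ↦ by simp⟩
  add_mem' := by
    rintro u u' ⟨g, h, H, N⟩ ⟨g', h', H', N'⟩
    exact ⟨g + g', h + h', H.add H', N.add N'⟩
  smul_mem' := by
    rintro c u ⟨g, h, H, N⟩
    exact ⟨c • g, c • h, H.smul c, N.smul c⟩

/-- The contribution of the number `lam` to a heat trace at time `t`: `exp (-lam t)` times the
multiplicity of `lam`, i.e. the dimension of its eigenspace (`0` if `lam` is no eigenvalue). -/
noncomputable def heatTerm {Ω : Opens Plane} (eigenspace : ℝ → Submodule ℝ (L2 Ω)) (t lam : ℝ) :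
    ℝ :=
  (Module.finrank ℝ (eigenspace lam) : ℝ) * Real.exp (-lam * t)

/-- The Dirichlet heat trace: the sum of `exp (-lam t)` over the Dirichlet eigenvalues `lam` of
`Ω`, counted with multiplicity. -/
noncomputable def dirichletHeatTrace (Ω : Opens Plane) (t : ℝ) : ℝ :=
  ∑' lam : ℝ, heatTerm (dirichletEigenspace Ω) t lam

/-- The Neumann heat trace: the sum of `exp (-lam t)` over the Neumann eigenvalues `lam` of
`Ω`, counted with multiplicity. -/
noncomputable def neumannHeatTrace (Ω : Opens Plane) (t : ℝ) : ℝ :=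
  ∑' lam : ℝ, heatTerm (neumannEigenspace Ω) t lam

/-- The open triangle with vertices `A`, `B`, `C`. -/
def openTriangle (A B C : Plane) : Opens Plane :=
  ⟨interior (convexHull ℝ {A, B, C}), isOpen_interior⟩

/-- As `t → 0⁺`, the remainder `R t` is `O(t⁻¹ exp (-c / t))`, and this is sharp: `R t` is also
bounded below in absolute value by a positive multiple of `t⁻¹ exp (-c / t)`, and `c` is the
supremum of the exponents `b > 0` for which `R t = O(exp (-b / t))`. -/
def IsSharpRemainder (R : ℝ → ℝ) (c : ℝ) : Prop :=
  R =O[𝓝[>] 0] (fun t ↦ t⁻¹ * Real.exp (-c / t)) ∧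
  (fun t ↦ t⁻¹ * Real.exp (-c / t)) =O[𝓝[>] 0] R ∧
  IsLUB {b : ℝ | 0 < b ∧ R =O[𝓝[>] 0] (fun t ↦ Real.exp (-b / t))} c

/-! The reflections in the sides of the triangle generate a discrete group, the affine Weyl group of
type G₂: a hexagonal lattice of translations extended by the dihedral group of order 12. The
triangle is a strict fundamental domain of it. Summing a plane wave with wave vector in the dual
lattice over the dihedral group, with sign s = -1 on reflections for Dirichlet and s = 1 for
Neumann, therefore gives eigenfunctions on the triangle (`eigenfun`), with eigenvalues 16π²/(9ℓ²) ·
(m² - mn + n²).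

That nothing is missing is proved by folding (`eq_zero_of_inner_eigenvec`): the twelve signed copies
of u dx are pushed to the torus, where the Fourier coefficients of their sum are the inner products
of u with the eigenfunctions. If these vanish, so does the measure, and the copies do not overlap,
so u = 0. Since eigenspaces of different eigenvalues are orthogonal, completeness turns into a
description of every eigenspace (`eigenspace_eq_span`). A basis is indexed by the lattice points of
the open chamber (Dirichlet) or the closed chamber (Neumann); independence comes from the
independence of characters (`linearIndependent_eigenvec`).

The heat trace is now a Gaussian sum over a chamber. With y = 16π²t/(9ℓ²), θ = `gaussianSum` and S
the Gaussian sum over the whole hexagonal lattice, counting orbits by their stabilizers gives (S +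
s(3θ(y) + 3θ(3y)) + 5)/12 (`hasSum_chamberPoint`). A parity split writes S through products of
one-dimensional sums (`tsum_hexForm`), and the inversion formula for θ converts everything to sums
in powers of q = exp(-3ℓ²/(16t)) (`hexTrace_eq`). S yields the area term and corrections from q⁴ on;
the two line sums yield the perimeter term and the terms in q and q³; the constant is 5/12. The
first omitted term is of exact size q⁴/t, produced by the six shortest translations, whence the
sharpness (`tendsto_hexTrace_remainder`). -/

/-! ### Gaussian sums -/

/-- The Gaussian sum `∑ exp (-y n²)` over the integers. -/
noncomputable def gaussianSum (y : ℝ) : ℝ := ∑' n : ℤ, Real.exp (-y * n ^ 2)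

theorem summable_gauss {y : ℝ} (hy : 0 < y) : Summable fun n : ℤ ↦ Real.exp (-y * n ^ 2) := by
  have hn : Summable fun n : ℕ ↦ Real.exp (-y * (n : ℝ) ^ 2) := by
    refine Summable.of_nonneg_of_le (fun _ ↦ (Real.exp_pos _).le) (fun n ↦ ?_)
      (Real.summable_exp_nat_mul_iff.2 (neg_lt_zero.2 hy))
    refine Real.exp_le_exp.2 ?_
    have h : (n : ℝ) ≤ (n : ℝ) ^ 2 := by exact_mod_cast Nat.le_self_pow two_ne_zero n
    nlinarith
  refine Summable.of_nat_of_neg ?_ ?_ <;> simpa using hn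

theorem gaussianSum_inversion {y : ℝ} (hy : 0 < y) :
    gaussianSum y = √(Real.pi / y) * gaussianSum (Real.pi ^ 2 / y) := by
  have h := Real.tsum_exp_neg_mul_int_sq (a := y / Real.pi) (by positivity)
  have hp := Real.pi_pos.ne'
  have e1 : -Real.pi * (y / Real.pi) = -y := by field_simp
  have e2 : -Real.pi / (y / Real.pi) = -(Real.pi ^ 2 / y) := by field_simp
  rw [e1, e2, ← Real.sqrt_eq_rpow, ← Real.sqrt_one, ← Real.sqrt_div zero_le_one] at h
  rw [gaussianSum, gaussianSum, h, one_div_div]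

/-- The terms n = 0, ±1 are the ones removed, and every other n has n² ≥ 4. -/
theorem exists_gaussianSum_bound :
    ∃ K : ℝ, ∀ y : ℝ, 1 ≤ y → |gaussianSum y - 1 - 2 * Real.exp (-y)| ≤ K * Real.exp (-4 * y) := by
  have hs := (summable_gauss one_pos).mul_left (Real.exp 4)
  refine ⟨∑' n : ℤ, Real.exp 4 * Real.exp (-1 * n ^ 2), fun y hy ↦ ?_⟩
  have hy0 : 0 < y := by linarith
  have hsum : gaussianSum y - 1 - 2 * Real.exp (-y) =
      ∑' n : ℤ, if n ∈ ({-1, 0, 1} : Finset ℤ) then 0 else Real.exp (-y * n ^ 2) := by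
    rw [gaussianSum, ← (summable_gauss hy0).sum_add_tsum_compl (s := {-1, 0, 1}),
      tsum_subtype (f := fun n : ℤ ↦ Real.exp (-y * n ^ 2))]
    have : ∀ n : ℤ, ((↑({-1, 0, 1} : Finset ℤ) : Set ℤ)ᶜ).indicator
        (fun n : ℤ ↦ Real.exp (-y * n ^ 2)) n =
        if n ∈ ({-1, 0, 1} : Finset ℤ) then 0 else Real.exp (-y * n ^ 2) := fun n ↦ by
      by_cases h : n ∈ ({-1, 0, 1} : Finset ℤ)
      · rw [if_pos h, Set.indicator_of_notMem (by simpa [or_iff_not_imp_left] using h)]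
      · rw [if_neg h, Set.indicator_of_mem (by simpa using h)]
    simp_rw [this]
    rw [Finset.sum_insert (by decide), Finset.sum_insert (by decide), Finset.sum_singleton]
    simp
    ring
  have hle : ∀ n : ℤ, (if n ∈ ({-1, 0, 1} : Finset ℤ) then 0 else Real.exp (-y * n ^ 2)) ≤
      Real.exp 4 * Real.exp (-1 * n ^ 2) * Real.exp (-4 * y) := fun n ↦ by
    split_ifs with h
    · positivity
    · rw [← Real.exp_add, ← Real.exp_add]
      -- The comparison of exponents is (y - 1)(n² - 4) ≥ 0.
      refine Real.exp_le_exp.2 ?_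
      simp only [Finset.mem_insert, Finset.mem_singleton, not_or] at h
      have h4 : (4 : ℤ) ≤ n ^ 2 := by
        rcases (by omega : n ≤ -2 ∨ 2 ≤ n) with h | h <;> nlinarith
      have h4 : (4 : ℝ) ≤ (n : ℝ) ^ 2 := by exact_mod_cast h4
      nlinarith
  have hnn : ∀ n : ℤ, 0 ≤ (if n ∈ ({-1, 0, 1} : Finset ℤ) then 0 else Real.exp (-y * n ^ 2)) :=
    fun n ↦ by split_ifs <;> positivity
  rw [hsum, abs_of_nonneg (tsum_nonneg hnn), ← tsum_mul_right]
  exact (Summable.of_nonneg_of_le hnn hle (hs.mul_right _)).tsum_le_tsum hle (hs.mul_right _)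

/-- The norm form of the hexagonal lattice. -/
def hexForm (k : ℤ × ℤ) : ℤ := k.1 ^ 2 - k.1 * k.2 + k.2 ^ 2

theorem summable_hexForm {y : ℝ} (hy : 0 < y) :
    Summable fun k : ℤ × ℤ ↦ Real.exp (-y * hexForm k) := by
  have h := (summable_gauss (half_pos hy)).mul_of_nonneg (summable_gauss (half_pos hy))
    (fun _ ↦ (Real.exp_pos _).le) (fun _ ↦ (Real.exp_pos _).le)
  refine Summable.of_nonneg_of_le (fun _ ↦ (Real.exp_pos _).le) (fun k ↦ ?_) h
  rw [← Real.exp_add]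
  refine Real.exp_le_exp.2 ?_
  have : ((hexForm k : ℤ) : ℝ) = (k.1 : ℝ) ^ 2 - k.1 * k.2 + (k.2 : ℝ) ^ 2 := by
    simp [hexForm]
  rw [this]
  nlinarith [mul_nonneg hy.le (sq_nonneg ((k.1 : ℝ) - k.2))]

theorem summable_comp_two_mul {f : ℤ → ℝ} (hf : Summable f) : Summable fun n ↦ f (2 * n) :=
  hf.comp_injective (i := fun n : ℤ ↦ 2 * n) fun a b h ↦ by simpa using h

theorem summable_comp_two_mul_add_one {f : ℤ → ℝ} (hf : Summable f) :
    Summable fun n ↦ f (2 * n + 1) :=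
  hf.comp_injective (i := fun n : ℤ ↦ 2 * n + 1) fun a b h ↦ by simpa using h

theorem tsum_int_even_add_odd {f : ℤ → ℝ} (hf : Summable f) :
    ∑' n, f n = ∑' n, f (2 * n) + ∑' n, f (2 * n + 1) :=
  (HasSum.add_isCompl Int.isCompl_even_odd
    ((mul_right_injective₀ (two_ne_zero' ℤ)).hasSum_range_iff.2
      (summable_comp_two_mul hf).hasSum |> fun h ↦ by rwa [range_two_mul] at h)
    (((add_left_injective 1).comp (mul_right_injective₀ (two_ne_zero' ℤ))).hasSum_range_iff.2
      (summable_comp_two_mul_add_one hf).hasSum |> fun h ↦ by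
        rwa [Function.comp_def, range_two_mul_add_one] at h)).tsum_eq

theorem tsum_gauss_half {y : ℝ} (hy : 0 < y) :
    ∑' n : ℤ, Real.exp (-y * (n + 1 / 2) ^ 2) = gaussianSum (y / 4) - gaussianSum y := by
  have h := tsum_int_even_add_odd (summable_gauss (y := y / 4) (by positivity))
  have e1 : ∀ n : ℤ, Real.exp (-(y / 4) * ((2 * n : ℤ) : ℝ) ^ 2) = Real.exp (-y * n ^ 2) :=
    fun n ↦ by congr 1; push_cast; ring
  have e2 : ∀ n : ℤ, Real.exp (-(y / 4) * ((2 * n + 1 : ℤ) : ℝ) ^ 2) =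
      Real.exp (-y * (n + 1 / 2) ^ 2) := fun n ↦ by congr 1; push_cast; ring
  simp_rw [e1, e2] at h
  rw [gaussianSum, gaussianSum, h]
  ring

/-- Completing the square, m² - mn + n² = (m - n/2)² + 3(n/2)². For even n a shift of m makes both
squares integral; for odd n both are squares of half-integers, summed by `tsum_gauss_half`. -/
theorem tsum_hexForm {y : ℝ} (hy : 0 < y) :
    ∑' k : ℤ × ℤ, Real.exp (-y * hexForm k) = gaussianSum y * gaussianSum (3 * y) +
      (gaussianSum (y / 4) - gaussianSum y) * (gaussianSum (3 * y / 4) - gaussianSum (3 * y)) := by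
  have hs := (summable_hexForm hy).prod_symm
  rw [← (Equiv.prodComm ℤ ℤ).tsum_eq]
  have hs' : Summable fun n : ℤ ↦ ∑' m : ℤ, Real.exp (-y * hexForm (m, n)) := hs.prod
  have h1 : ∑' k : ℤ × ℤ, Real.exp (-y * hexForm (Equiv.prodComm ℤ ℤ k)) =
      ∑' n : ℤ, ∑' m : ℤ, Real.exp (-y * hexForm (m, n)) := hs.tsum_prod
  rw [h1, tsum_int_even_add_odd hs']
  have e1 : ∀ n : ℤ, ∑' m : ℤ, Real.exp (-y * hexForm (m, 2 * n)) =
      gaussianSum y * Real.exp (-(3 * y) * n ^ 2) := fun n ↦ by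
    rw [← (Equiv.addRight n).tsum_eq, gaussianSum, ← tsum_mul_right]
    refine tsum_congr fun m ↦ ?_
    rw [← Real.exp_add]
    congr 1
    simp only [hexForm, Equiv.coe_addRight]
    push_cast
    ring
  have e2 : ∀ n : ℤ, ∑' m : ℤ, Real.exp (-y * hexForm (m, 2 * n + 1)) =
      (gaussianSum (y / 4) - gaussianSum y) * Real.exp (-(3 * y) * (n + 1 / 2) ^ 2) := fun n ↦ by
    rw [← tsum_gauss_half hy, ← (Equiv.addRight (n + 1)).tsum_eq, ← tsum_mul_right]
    refine tsum_congr fun m ↦ ?_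
    rw [← Real.exp_add]
    congr 1
    simp only [hexForm, Equiv.coe_addRight]
    push_cast
    ring
  simp_rw [e1, e2]
  rw [tsum_mul_left, tsum_mul_left, tsum_gauss_half (by positivity), ← gaussianSum]

/-! ### The dihedral action on the hexagonal lattice -/

/-- The twelve automorphisms of the form `hexForm`: six rotations, then six reflections. -/
def hexAct (g : Fin 12) (k : ℤ × ℤ) : ℤ × ℤ :=
  ![(k.1, k.2), (k.1 - k.2, k.1), (-k.2, k.1 - k.2), (-k.1, -k.2), (k.2 - k.1, -k.1),
    (k.2, k.2 - k.1), (k.2, k.1), (k.1, k.1 - k.2), (k.1 - k.2, -k.2), (-k.2, -k.1),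
    (-k.1, k.2 - k.1), (k.2 - k.1, k.2)] g

/-- `hexAct (hexInv g)` is the inverse of `hexAct g`. -/
def hexInv : Fin 12 → Fin 12 := ![0, 5, 4, 3, 2, 1, 6, 7, 8, 9, 10, 11]

/-- The automorphism `hexAct g` as a permutation. -/
def hexPerm (g : Fin 12) : ℤ × ℤ ≃ ℤ × ℤ where
  toFun := hexAct g
  invFun := hexAct (hexInv g)
  left_inv k := by fin_cases g <;> simp [hexAct, hexInv]
  right_inv k := by fin_cases g <;> simp [hexAct, hexInv]

theorem hexForm_hexAct (g : Fin 12) (k : ℤ × ℤ) : hexForm (hexAct g k) = hexForm k := by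
  fin_cases g <;> simp [hexAct, hexForm] <;> ring

/-- The points of the hexagonal lattice in the closed (`d = 0`) and open (`d = 1`) fundamental
chamber, parametrized by pairs of natural numbers. -/
def chamberPoint (d : ℕ) (p : ℕ × ℕ) : ℤ × ℤ :=
  ((p.1 + d) + 2 * (p.2 + d), (p.1 + d) + (p.2 + d))

theorem chamberPoint_injective (d : ℕ) : Function.Injective (chamberPoint d) := fun p q h ↦ by
  simp only [chamberPoint, Prod.mk.injEq] at h
  ext <;> omega

theorem mem_range_chamberPoint {d : ℕ} {k : ℤ × ℤ} :
    k ∈ Set.range (chamberPoint d) ↔ (d : ℤ) ≤ k.1 - k.2 ∧ (d : ℤ) ≤ 2 * k.2 - k.1 := by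
  constructor
  · rintro ⟨p, rfl⟩
    simp only [chamberPoint]
    omega
  · rintro ⟨h1, h2⟩
    refine ⟨((2 * k.2 - k.1 - d).toNat, (k.1 - k.2 - d).toNat), ?_⟩
    simp only [chamberPoint]
    ext <;> simp only <;> omega

/-- The count is the order of the stabilizer of k: 1 in general, 2 on one of the six reflection
lines, and 12 = 1 + 6 + 5 at the origin. It depends only on the position of k relative to the six
lines, so finitely many sign patterns suffice. -/
theorem card_hexAct_chamber_closed (k : ℤ × ℤ) :
    ∑ g, (if ((0 : ℕ) : ℤ) ≤ (hexAct g k).1 - (hexAct g k).2 ∧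
      ((0 : ℕ) : ℤ) ≤ 2 * (hexAct g k).2 - (hexAct g k).1 then (1 : ℤ) else 0) =
    1 + ((if k.1 = k.2 then 1 else 0) + (if k.2 = 0 then 1 else 0) + (if k.1 = 0 then 1 else 0) +
      (if k.1 = 2 * k.2 then 1 else 0) + (if k.1 = -k.2 then 1 else 0) +
      (if k.2 = 2 * k.1 then 1 else 0)) + 5 * (if k = 0 then 1 else 0) := by
  obtain ⟨m, n⟩ := k
  simp only [Fin.sum_univ_succ, hexAct, Prod.mk_eq_zero]
  simp
  rcases lt_trichotomy m 0 with h1 | h1 | h1 <;> rcases lt_trichotomy n 0 with h2 | h2 | h2 <;>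
  rcases lt_trichotomy m n with h3 | h3 | h3 <;> (try (exfalso; omega)) <;>
  rcases lt_trichotomy (m + n) 0 with h4 | h4 | h4 <;> (try (exfalso; omega)) <;>
  rcases lt_trichotomy m (2 * n) with h5 | h5 | h5 <;> (try (exfalso; omega)) <;>
  rcases lt_trichotomy n (2 * m) with h6 | h6 | h6 <;> (try (exfalso; omega)) <;>
  simp (disch := omega) only [if_pos, if_neg] <;> norm_num

/-- The orbit of k meets the open chamber exactly once off the reflection lines and never on them;
at the origin 1 - 6 + 5 = 0. -/
theorem card_hexAct_chamber_open (k : ℤ × ℤ) :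
    ∑ g, (if ((1 : ℕ) : ℤ) ≤ (hexAct g k).1 - (hexAct g k).2 ∧
      ((1 : ℕ) : ℤ) ≤ 2 * (hexAct g k).2 - (hexAct g k).1 then (1 : ℤ) else 0) =
    1 + -1 * ((if k.1 = k.2 then 1 else 0) + (if k.2 = 0 then 1 else 0) +
      (if k.1 = 0 then 1 else 0) + (if k.1 = 2 * k.2 then 1 else 0) +
      (if k.1 = -k.2 then 1 else 0) + (if k.2 = 2 * k.1 then 1 else 0)) +
      5 * (if k = 0 then 1 else 0) := by
  obtain ⟨m, n⟩ := k
  simp only [Fin.sum_univ_succ, hexAct, Prod.mk_eq_zero]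
  simp
  rcases lt_trichotomy m 0 with h1 | h1 | h1 <;> rcases lt_trichotomy n 0 with h2 | h2 | h2 <;>
  rcases lt_trichotomy m n with h3 | h3 | h3 <;> (try (exfalso; omega)) <;>
  rcases lt_trichotomy (m + n) 0 with h4 | h4 | h4 <;> (try (exfalso; omega)) <;>
  rcases lt_trichotomy m (2 * n) with h5 | h5 | h5 <;> (try (exfalso; omega)) <;>
  rcases lt_trichotomy n (2 * m) with h6 | h6 | h6 <;> (try (exfalso; omega)) <;>
  simp (disch := omega) only [if_pos, if_neg] <;> norm_num

theorem hasSum_ite_range {ι κ : Type*} {i : ι → κ} (hi : Function.Injective i) {P : κ → Prop}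
    [DecidablePred P] (hP : ∀ k, P k ↔ k ∈ Set.range i) {w : κ → ℝ} {a : ℝ}
    (h : HasSum (fun j ↦ w (i j)) a) : HasSum (fun k ↦ (if P k then 1 else 0) * w k) a := by
  rw [← hi.hasSum_iff]
  · refine h.congr_fun fun j ↦ ?_
    simp [(hP _).2 ⟨j, rfl⟩]
  · intro k hk
    rw [if_neg (mt (hP k).1 hk), zero_mul]

theorem hasSum_line {y : ℝ} (hy : 0 < y) {c : ℝ} (hc : 0 < c) (i : ℤ → ℤ × ℤ)
    (hi : Function.Injective i) {P : ℤ × ℤ → Prop} [DecidablePred P]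
    (hP : ∀ k, P k ↔ k ∈ Set.range i) (hQ : ∀ n, (hexForm (i n) : ℝ) = c * (n : ℝ) ^ 2) :
    HasSum (fun k ↦ (if P k then 1 else 0) * Real.exp (-y * hexForm k)) (gaussianSum (c * y)) := by
  refine hasSum_ite_range hi hP ((summable_gauss (mul_pos hc hy)).hasSum.congr_fun fun n ↦ ?_)
  rw [hQ]
  congr 1
  ring

/-- Double counting: since `hexForm` is invariant, each of the twelve translates of the chamber has
the same Gaussian sum, and `hcard` says how often each lattice point is covered. On three of the six
lines the form is n², on the other three it is 3n². -/
theorem hasSum_chamberPoint {y : ℝ} (hy : 0 < y) {s : ℤ} {d : ℕ}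
    (hcard : ∀ k : ℤ × ℤ, ∑ g, (if (d : ℤ) ≤ (hexAct g k).1 - (hexAct g k).2 ∧
      (d : ℤ) ≤ 2 * (hexAct g k).2 - (hexAct g k).1 then (1 : ℤ) else 0) =
    1 + s * ((if k.1 = k.2 then 1 else 0) + (if k.2 = 0 then 1 else 0) +
      (if k.1 = 0 then 1 else 0) + (if k.1 = 2 * k.2 then 1 else 0) +
      (if k.1 = -k.2 then 1 else 0) + (if k.2 = 2 * k.1 then 1 else 0)) +
      5 * (if k = 0 then 1 else 0)) :
    HasSum (fun p ↦ Real.exp (-y * hexForm (chamberPoint d p)))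
      ((∑' k : ℤ × ℤ, Real.exp (-y * hexForm k) +
        s * (3 * gaussianSum y + 3 * gaussianSum (3 * y)) + 5) / 12) := by
  set w : ℤ × ℤ → ℝ := fun k ↦ Real.exp (-y * hexForm k) with hw
  have hsT : Summable fun p ↦ w (chamberPoint d p) :=
    (summable_hexForm hy).comp_injective (chamberPoint_injective d)
  set T := ∑' p, w (chamberPoint d p) with hT
  have h0 := hasSum_ite_range (w := w) (chamberPoint_injective d)
    (fun k ↦ mem_range_chamberPoint.symm) hsT.hasSum
  have hg (g : Fin 12) := (hexPerm g).hasSum_iff.2 h0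
  have hleft := hasSum_sum (s := Finset.univ) fun g _ ↦ hg g
  have l1 := hasSum_line hy one_pos (fun n ↦ (n, n)) (fun a b h ↦ by simpa using h)
    (P := fun k ↦ k.1 = k.2) (fun k ↦ ⟨fun h ↦ ⟨k.1, Prod.ext rfl h⟩, by rintro ⟨n, rfl⟩; rfl⟩)
    (fun n ↦ by simp [hexForm]; ring)
  have l2 := hasSum_line hy one_pos (fun n ↦ (n, 0)) (fun a b h ↦ by simpa using h)
    (P := fun k ↦ k.2 = 0) (fun k ↦ ⟨fun h ↦ ⟨k.1, Prod.ext rfl h.symm⟩, by rintro ⟨n, rfl⟩; rfl⟩)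
    (fun n ↦ by simp [hexForm])
  have l3 := hasSum_line hy one_pos (fun n ↦ (0, n)) (fun a b h ↦ by simpa using h)
    (P := fun k ↦ k.1 = 0) (fun k ↦ ⟨fun h ↦ ⟨k.2, Prod.ext h.symm rfl⟩, by rintro ⟨n, rfl⟩; rfl⟩)
    (fun n ↦ by simp [hexForm])
  have l4 := hasSum_line hy three_pos (fun n ↦ (2 * n, n)) (fun a b h ↦ by simpa using h)
    (P := fun k ↦ k.1 = 2 * k.2)
    (fun k ↦ ⟨fun h ↦ ⟨k.2, Prod.ext h.symm rfl⟩, by rintro ⟨n, rfl⟩; rfl⟩)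
    (fun n ↦ by simp [hexForm]; ring)
  have l5 := hasSum_line hy three_pos (fun n ↦ (-n, n)) (fun a b h ↦ by simpa using h)
    (P := fun k ↦ k.1 = -k.2)
    (fun k ↦ ⟨fun h ↦ ⟨k.2, Prod.ext h.symm rfl⟩, by rintro ⟨n, rfl⟩; rfl⟩)
    (fun n ↦ by simp [hexForm]; ring)
  have l6 := hasSum_line hy three_pos (fun n ↦ (n, 2 * n)) (fun a b h ↦ by simpa using h)
    (P := fun k ↦ k.2 = 2 * k.1)
    (fun k ↦ ⟨fun h ↦ ⟨k.1, Prod.ext rfl h.symm⟩, by rintro ⟨n, rfl⟩; rfl⟩)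
    (fun n ↦ by simp [hexForm]; ring)
  have hz : HasSum (fun k : ℤ × ℤ ↦ (if k = 0 then 1 else 0) * w k) 1 := by
    have := hasSum_ite_eq (0 : ℤ × ℤ) (1 : ℝ)
    refine this.congr_fun fun k ↦ ?_
    by_cases h : k = 0
    · subst h
      simp [hw, hexForm]
    · simp [h]
  have hr := ((summable_hexForm hy).hasSum.add
    ((((((l1.add l2).add l3).add l4).add l5).add l6).mul_left (s : ℝ))).add (hz.mul_left 5)
  have he := hleft.unique (hr.congr_fun fun k ↦ ?_)
  · rw [Finset.sum_const, Finset.card_univ, Fintype.card_fin, nsmul_eq_mul] at he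
    convert hsT.hasSum using 1
    rw [← hT, one_mul] at *
    push_cast at he
    linarith
  · have hc := congrArg (Int.cast : ℤ → ℝ) (hcard k)
    push_cast at hc
    have hw' (g : Fin 12) : w (hexAct g k) = w k := by simp only [hw, hexForm_hexAct]
    simp only [hexPerm, Function.comp_apply, Equiv.coe_fn_mk, hw']
    rw [← Finset.sum_mul, hc]
    ring

theorem hasSum_chamberPoint_closed {y : ℝ} (hy : 0 < y) :
    HasSum (fun p ↦ Real.exp (-y * hexForm (chamberPoint 0 p)))
      ((∑' k : ℤ × ℤ, Real.exp (-y * hexForm k) +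
        (3 * gaussianSum y + 3 * gaussianSum (3 * y)) + 5) / 12) := by
  simpa using hasSum_chamberPoint hy (s := 1) fun k ↦ by
    rw [one_mul]; exact card_hexAct_chamber_closed k

theorem hasSum_chamberPoint_open {y : ℝ} (hy : 0 < y) :
    HasSum (fun p ↦ Real.exp (-y * hexForm (chamberPoint 1 p)))
      ((∑' k : ℤ × ℤ, Real.exp (-y * hexForm k) -
        (3 * gaussianSum y + 3 * gaussianSum (3 * y)) + 5) / 12) := by
  convert hasSum_chamberPoint hy card_hexAct_chamber_open using 1
  push_cast
  ring

/-! ### Short-time asymptotics of the lattice trace. -/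

theorem isSharpRemainder_of_tendsto {R : ℝ → ℝ} {c L : ℝ} (hc : 0 < c) (hL : L ≠ 0)
    (h : Tendsto (fun t ↦ R t / (t⁻¹ * Real.exp (-c / t))) (𝓝[>] 0) (𝓝 L)) :
    IsSharpRemainder R c := by
  have hne : ∀ᶠ t : ℝ in 𝓝[>] 0, t⁻¹ * Real.exp (-c / t) ≠ 0 := by
    filter_upwards [self_mem_nhdsWithin] with t ht
    have : (0 : ℝ) < t := ht
    positivity
  have h1 : R =O[𝓝[>] 0] (fun t ↦ t⁻¹ * Real.exp (-c / t)) :=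
    isBigO_of_div_tendsto_nhds (hne.mono fun t ht h0 ↦ absurd h0 ht) L h
  have h2 : (fun t ↦ t⁻¹ * Real.exp (-c / t)) =O[𝓝[>] 0] R := by
    have h' := h.inv₀ hL
    have hR : ∀ᶠ t in 𝓝[>] 0, R t ≠ 0 := by
      filter_upwards [h.eventually_ne hL] with t ht h0
      simp [h0] at ht
    refine isBigO_of_div_tendsto_nhds (hR.mono fun t ht h0 ↦ absurd h0 ht) L⁻¹ (h'.congr fun t ↦ ?_)
    simp [inv_div]
  have hlim (b : ℝ) (hb : 0 < b) :
      Tendsto (fun t : ℝ ↦ t⁻¹ * Real.exp (-b / t)) (𝓝[>] 0) (𝓝 0) := by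
    have := (Real.tendsto_pow_mul_exp_neg_atTop_nhds_zero 1).comp
      (tendsto_inv_nhdsGT_zero.const_mul_atTop hb)
    have := this.const_mul b⁻¹
    rw [mul_zero] at this
    refine this.congr fun t ↦ ?_
    simp only [Function.comp_apply, pow_one]
    rw [← mul_assoc, inv_mul_cancel_left₀ hb.ne']
    congr 2
    ring
  refine ⟨h1, h2, fun b hb ↦ ?_, fun b hb ↦ ?_⟩
  -- An admissible exponent b > c would make t⁻¹ exp(-c/t) negligible against itself.
  · by_contra! hcb
    obtain ⟨hb0, hb⟩ := hb
    have h3 := h2.trans hb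
    have h4 : (fun t : ℝ ↦ Real.exp (-b / t)) =o[𝓝[>] 0] (fun t ↦ t⁻¹ * Real.exp (-c / t)) := by
      rw [isLittleO_iff_tendsto' (hne.mono fun t ht h0 ↦ absurd h0 ht)]
      have h5 : Tendsto (fun t : ℝ ↦ t * (t * (t⁻¹ * Real.exp (-(b - c) / t)))) (𝓝[>] 0) (𝓝 0) := by
        have ht : Tendsto (fun t : ℝ ↦ t) (𝓝[>] 0) (𝓝 0) := nhdsWithin_le_nhds
        simpa using ht.mul (ht.mul (hlim (b - c) (by linarith)))
      refine h5.congr' ?_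
      filter_upwards [self_mem_nhdsWithin] with t ht
      have ht : (0 : ℝ) < t := ht
      have : Real.exp (-b / t) = Real.exp (-(b - c) / t) * Real.exp (-c / t) := by
        rw [← Real.exp_add]
        congr 1
        ring
      rw [this]
      field_simp
    have h6 := h3.trans_isLittleO h4
    have h7 := (h6.def (c := 1 / 2) (by norm_num)).and hne
    obtain ⟨t, ht, ht'⟩ := h7.exists
    have := norm_pos_iff.2 ht'
    linarith
  -- The factor t⁻¹ makes c itself inadmissible, so the supremum is only approached, through
  -- exponents a' < c; taking the maximum with 0 keeps a' positive.
  · refine le_of_forall_lt fun a ha ↦ ?_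
    obtain ⟨a', h0, h1'⟩ := exists_between (max_lt ha hc)
    refine lt_of_lt_of_le ((le_max_left _ _).trans_lt h0) (hb ⟨(le_max_right _ _).trans_lt h0, ?_⟩)
    refine h1.trans ?_
    refine (isLittleO_of_tendsto (fun t h0 ↦ absurd h0 (Real.exp_ne_zero _)) ?_).isBigO
    refine (hlim (c - a') (by linarith)).congr fun t ↦ ?_
    rw [mul_div_assoc, ← Real.exp_sub]
    congr 2
    ring

theorem tendsto_gaussianSum_remainder_mul {α : Type*} {l : Filter α} {Y w : α → ℝ}
    (hY : Tendsto Y l atTop) (hw : Tendsto w l (𝓝 0)) :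
    Tendsto (fun t ↦ (gaussianSum (Y t) - 1 - 2 * Real.exp (-Y t)) * Real.exp (4 * Y t) * w t) l
      (𝓝 0) := by
  obtain ⟨K, hK⟩ := exists_gaussianSum_bound
  refine isBoundedUnder_le_mul_tendsto_zero ⟨K, ?_⟩ hw
  rw [eventually_map]
  filter_upwards [hY.eventually_ge_atTop 1] with t hy
  simp only [Function.comp_apply, norm_mul, Real.norm_eq_abs, Real.abs_exp]
  calc _ ≤ K * Real.exp (-4 * Y t) * Real.exp (4 * Y t) := by gcongr; exact hK _ hy
    _ = K := by rw [mul_assoc, ← Real.exp_add]; simp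

theorem tendsto_gaussianSum_sub_one :
    Tendsto (fun y ↦ (gaussianSum y - 1) * Real.exp y) atTop (𝓝 2) := by
  have h3 : Tendsto (fun y : ℝ ↦ Real.exp (-(3 * y))) atTop (𝓝 0) :=
    Real.tendsto_exp_neg_atTop_nhds_zero.comp (tendsto_id.const_mul_atTop three_pos)
  have h := tendsto_gaussianSum_remainder_mul tendsto_id h3
  have h' := h.add_const 2
  rw [zero_add] at h'
  refine h'.congr fun y ↦ ?_
  have e1 : Real.exp (4 * y) * Real.exp (-(3 * y)) = Real.exp y := by
    rw [← Real.exp_add]; congr 1; ring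
  have e2 : Real.exp (-y) * Real.exp y = 1 := by rw [← Real.exp_add]; simp
  simp only [id]
  linear_combination (gaussianSum y - 1 - 2 * Real.exp (-y)) * e1 - 2 * e2

/-- `(S + s (3 θ(y) + 3 θ(3y)) + 5) / 12` with `y = 16π²t/(9ℓ²)`, where `S` is the Gaussian sum over
the hexagonal lattice and `θ` the Gaussian sum over the integers. -/
noncomputable def hexTrace (s ℓ t : ℝ) : ℝ :=
  (∑' k : ℤ × ℤ, Real.exp (-(16 * Real.pi ^ 2 * t / (9 * ℓ ^ 2)) * hexForm k) +
    s * (3 * gaussianSum (16 * Real.pi ^ 2 * t / (9 * ℓ ^ 2)) +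
      3 * gaussianSum (3 * (16 * Real.pi ^ 2 * t / (9 * ℓ ^ 2)))) + 5) / 12

/-- Inversion exchanges y, 3y, y/4, 3y/4 with Y, Y/3, 4Y, 4Y/3, where Y = π²/y. The prefactor
doubles when y is divided by 4, which is the source of the coefficients 2 before `gaussianSum (4 *
Y)` and `gaussianSum (4 * (Y / 3))`. -/
theorem hexTrace_eq {s ℓ t : ℝ} (hℓ : 0 < ℓ) (ht : 0 < t) {Y w : ℝ}
    (hY : Y = 9 * ℓ ^ 2 / (16 * t)) (hw : w = √(Real.pi * t)) :
    hexTrace s ℓ t = √3 * ℓ ^ 2 / (64 * Real.pi * t) * (gaussianSum Y * gaussianSum (Y / 3) +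
      (2 * gaussianSum (4 * Y) - gaussianSum Y) *
        (2 * gaussianSum (4 * (Y / 3)) - gaussianSum (Y / 3))) +
      s * (3 * ℓ / (16 * w) * gaussianSum Y + √3 * ℓ / (16 * w) * gaussianSum (Y / 3)) + 5 / 12 := by
  have hp := Real.pi_pos
  set y := 16 * Real.pi ^ 2 * t / (9 * ℓ ^ 2) with hy
  have hy0 : 0 < y := by positivity
  have hw0 : 0 < w := by rw [hw]; positivity
  have hw2 : w ^ 2 = Real.pi * t := by rw [hw]; exact Real.sq_sqrt (by positivity)
  have h3 : √3 ^ 2 = 3 := Real.sq_sqrt (by norm_num)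
  have h30 : 0 < √3 := by positivity
  have hs1 : √(Real.pi / y) = 3 * ℓ / (4 * w) := by
    rw [Real.sqrt_eq_iff_mul_self_eq (by positivity) (by positivity), hy]
    field_simp
    rw [hw2]
    ring
  have hs2 : √(Real.pi / (3 * y)) = √3 * ℓ / (4 * w) := by
    rw [Real.sqrt_eq_iff_mul_self_eq (by positivity) (by positivity), hy]
    field_simp
    rw [hw2, h3]
    ring
  have hs3 : √(Real.pi / (y / 4)) = 2 * (3 * ℓ / (4 * w)) := by
    rw [← hs1, show Real.pi / (y / 4) = 2 ^ 2 * (Real.pi / y) by ring,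
      Real.sqrt_mul (by positivity), Real.sqrt_sq (by norm_num)]
  have hs4 : √(Real.pi / (3 * y / 4)) = 2 * (√3 * ℓ / (4 * w)) := by
    rw [← hs2, show Real.pi / (3 * y / 4) = 2 ^ 2 * (Real.pi / (3 * y)) by ring,
      Real.sqrt_mul (by positivity), Real.sqrt_sq (by norm_num)]
  have hYy : Y = Real.pi ^ 2 / y := by
    rw [hY, hy]
    field_simp
  have i1 := gaussianSum_inversion hy0
  have i2 := gaussianSum_inversion (y := 3 * y) (by positivity)
  have i3 := gaussianSum_inversion (y := y / 4) (by positivity)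
  have i4 := gaussianSum_inversion (y := 3 * y / 4) (by positivity)
  rw [hs1, ← hYy] at i1
  rw [hs2, show Real.pi ^ 2 / (3 * y) = Y / 3 by rw [hYy]; ring] at i2
  rw [hs3, show Real.pi ^ 2 / (y / 4) = 4 * Y by rw [hYy]; ring] at i3
  rw [hs4, show Real.pi ^ 2 / (3 * y / 4) = 4 * (Y / 3) by rw [hYy]; ring] at i4
  rw [hexTrace, ← hy, tsum_hexForm hy0, i1, i2, i3, i4]
  have hpt : 64 * Real.pi * t = 64 * w ^ 2 := by rw [hw2]; ring
  rw [hpt]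
  field_simp
  ring

/-- With q = exp(-3ℓ²/(16t)), the subtracted expression consists of the constant parts and of the
terms in q and q³. The line sums also have a term in q⁴, but with t^(-1/2) in place of t⁻¹, so the
limit comes from the area part alone and does not depend on s. The factor 12 is twice the number of
shortest vectors of a hexagonal lattice. -/
theorem tendsto_hexTrace_remainder {s ℓ : ℝ} (hℓ : 0 < ℓ) :
    Tendsto (fun t ↦ (hexTrace s ℓ t -
      (ℓ ^ 2 * √3 / (32 * Real.pi * t) + s * (ℓ * (3 + √3) / (16 * √(Real.pi * t))) + 5 / 12
        + s * (ℓ / 8 * √(3 / (Real.pi * t)) * Real.exp (-(3 * ℓ ^ 2) / (16 * t)))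
        + s * (3 * ℓ / (8 * √(Real.pi * t)) * Real.exp (-(9 * ℓ ^ 2) / (16 * t))))) /
          (t⁻¹ * Real.exp (-(3 * ℓ ^ 2 / 4) / t)))
      (𝓝[>] 0) (𝓝 (√3 * ℓ ^ 2 / (64 * Real.pi) * 12)) := by
  have hp := Real.pi_pos
  set Y : ℝ → ℝ := fun t ↦ 9 * ℓ ^ 2 / 16 * t⁻¹ with hY
  have hYt : Tendsto Y (𝓝[>] 0) atTop :=
    tendsto_inv_nhdsGT_zero.const_mul_atTop (by positivity)
  have hY3 : Tendsto (fun t ↦ Y t / 3) (𝓝[>] 0) atTop := hYt.atTop_div_const three_pos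
  have hY4 : Tendsto (fun t ↦ 4 * Y t) (𝓝[>] 0) atTop := hYt.const_mul_atTop four_pos
  have hY5 : Tendsto (fun t ↦ 4 * (Y t / 3)) (𝓝[>] 0) atTop := hY3.const_mul_atTop four_pos
  have ta := tendsto_gaussianSum_sub_one.comp hYt
  have tb := tendsto_gaussianSum_sub_one.comp hY3
  have tc := tendsto_gaussianSum_sub_one.comp hY4
  have td := tendsto_gaussianSum_sub_one.comp hY5
  have tq : Tendsto (fun t ↦ Real.exp (-(Y t / 3))) (𝓝[>] 0) (𝓝 0) :=
    Real.tendsto_exp_neg_atTop_nhds_zero.comp hY3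
  have tw : Tendsto (fun t : ℝ ↦ √(Real.pi * t)) (𝓝[>] 0) (𝓝 0) := by
    have : ContinuousAt (fun t : ℝ ↦ √(Real.pi * t)) 0 := by fun_prop
    simpa [ContinuousAt] using this.tendsto.mono_left (nhdsWithin_le_nhds (s := Set.Ioi 0))
  have ua := (tendsto_gaussianSum_remainder_mul hYt tw).mul (tq.pow 8)
  have ub := tendsto_gaussianSum_remainder_mul hY3 tw
  -- Let α, β, γ, δ be `gaussianSum` minus 1 at Y, Y/3, 4Y, 4Y/3. The linear terms in α and β
  -- cancel, and the area factor is 2 + 2αβ + 2δ - 2αδ + 2γ - 2γβ + 4γδ. After division by q⁴, 2αβ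
  -- tends to 8 and 2δ to 4, while the other terms retain positive powers of q.
  have hP := ((((((ta.mul tb).const_mul 2).add (td.const_mul 2)).sub
    (((tq.pow 3).mul (ta.mul td)).const_mul 2)).add (((tq.pow 8).mul tc).const_mul 2)).sub
    (((tq.pow 9).mul (tc.mul tb)).const_mul 2)).add (((tq.pow 12).mul (tc.mul td)).const_mul 4)
  have hT := ((hP.const_mul (√3 * ℓ ^ 2 / (64 * Real.pi))).add
    (ua.const_mul (s * (3 * ℓ / (16 * Real.pi))))).add
    (ub.const_mul (s * (√3 * ℓ / (16 * Real.pi))))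
  refine (hT.congr' ?_).trans (le_of_eq ?_)
  · filter_upwards [self_mem_nhdsWithin] with t ht
    have ht : (0 : ℝ) < t := ht
    have hYe : Y t = 9 * ℓ ^ 2 / (16 * t) := by simp only [hY]; field_simp
    rw [hexTrace_eq hℓ ht hYe rfl]
    set w := √(Real.pi * t) with hw
    have hw0 : 0 < w := by rw [hw]; positivity
    have hw2 : w ^ 2 = Real.pi * t := by rw [hw]; exact Real.sq_sqrt (by positivity)
    set q := Real.exp (-(Y t / 3)) with hq
    have hq0 : 0 < q := Real.exp_pos _
    have e1 : Real.exp (-(3 * ℓ ^ 2) / (16 * t)) = q := by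
      rw [hq, hYe]; congr 1; field_simp; ring
    have e3 : Real.exp (-(9 * ℓ ^ 2) / (16 * t)) = q ^ 3 := by
      rw [hq, ← Real.exp_nat_mul, hYe]; congr 1; push_cast; field_simp
    have e4 : Real.exp (-(3 * ℓ ^ 2 / 4) / t) = q ^ 4 := by
      rw [hq, ← Real.exp_nat_mul, hYe]; congr 1; push_cast; field_simp; ring
    have f1 : Real.exp (Y t / 3) = q⁻¹ := by rw [hq, Real.exp_neg, inv_inv]
    have f3 : Real.exp (Y t) = (q ^ 3)⁻¹ := by
      rw [← inv_pow, ← f1, ← Real.exp_nat_mul]; congr 1; push_cast; ring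
    have f3' : Real.exp (-Y t) = q ^ 3 := by rw [Real.exp_neg, f3, inv_inv]
    have f4 : Real.exp (4 * (Y t / 3)) = (q ^ 4)⁻¹ := by
      rw [← inv_pow, ← f1, ← Real.exp_nat_mul]; congr 1
    have f12 : Real.exp (4 * Y t) = (q ^ 12)⁻¹ := by
      rw [← inv_pow, ← f1, ← Real.exp_nat_mul]; congr 1; push_cast; ring
    have g1 : √(3 / (Real.pi * t)) = √3 / w := by rw [hw, Real.sqrt_div (by norm_num)]
    have ht' : t = w ^ 2 / Real.pi := by rw [hw2]; field_simp
    simp only [Function.comp_apply]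
    rw [e1, e3, e4, f1, f3, f3', f4, f12, g1]
    generalize gaussianSum (Y t) = a
    generalize gaussianSum (Y t / 3) = b
    generalize gaussianSum (4 * Y t) = c
    generalize gaussianSum (4 * (Y t / 3)) = d
    clear_value w q
    subst ht'
    field_simp
    ring
  · congr 1
    ring

theorem isSharpRemainder_hexTrace {s ℓ : ℝ} (hℓ : 0 < ℓ) :
    IsSharpRemainder (fun t ↦ hexTrace s ℓ t -
      (ℓ ^ 2 * √3 / (32 * Real.pi * t) + s * (ℓ * (3 + √3) / (16 * √(Real.pi * t))) + 5 / 12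
        + s * (ℓ / 8 * √(3 / (Real.pi * t)) * Real.exp (-(3 * ℓ ^ 2) / (16 * t)))
        + s * (3 * ℓ / (8 * √(Real.pi * t)) * Real.exp (-(9 * ℓ ^ 2) / (16 * t)))))
      (3 * ℓ ^ 2 / 4) :=
  isSharpRemainder_of_tendsto (by positivity) (by positivity) (tendsto_hexTrace_remainder hℓ)

/-! ### Smooth functions and weak derivatives -/

theorem inner_toLp {Ω : Opens Plane} (u : L2 Ω) {f : Plane → ℝ}
    (hf : MemLp f 2 (volume.restrict (Ω : Set Plane))) :
    inner ℝ u (hf.toLp f) = ∫ x in (Ω : Set Plane), u x * f x := by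
  rw [L2.inner_def]
  refine integral_congr_ae ?_
  filter_upwards [hf.coeFn_toLp] with x hx
  simp [hx, mul_comm]

theorem partialDeriv_apply_contDiff {f : Plane → ℝ} (hf : ContDiff ℝ (⊤ : ℕ∞) f) (i : Fin 2) :
    ContDiff ℝ (⊤ : ℕ∞) (partialDeriv i f) :=
  (hf.fderiv_right (m := (⊤ : ℕ∞)) (by exact le_rfl)).clm_apply contDiff_const

theorem memLp_of_continuous {Ω : Opens Plane} (hΩ : Bornology.IsBounded (Ω : Set Plane))
    {f : Plane → ℝ} (hf : Continuous f) : MemLp f 2 (volume.restrict (Ω : Set Plane)) := by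
  have hK : IsCompact (closure (Ω : Set Plane)) := hΩ.isCompact_closure
  have : IsFiniteMeasure (volume.restrict (Ω : Set Plane)) := ⟨by
    rw [Measure.restrict_apply_univ]
    exact hΩ.measure_lt_top⟩
  obtain ⟨M, hM⟩ := hK.exists_bound_of_continuousOn hf.continuousOn
  refine MemLp.of_bound hf.aestronglyMeasurable M ?_
  filter_upwards [ae_restrict_mem Ω.isOpen.measurableSet] with x hx
  exact hM x (subset_closure hx)

/-- The test function and its derivatives vanish off Ω, so both integrals extend to the plane, where
integration by parts has no boundary term. -/
theorem hasWeakPartial_toLp {Ω : Opens Plane} {f : Plane → ℝ} (hf : ContDiff ℝ (⊤ : ℕ∞) f)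
    (i : Fin 2) (h0 : MemLp f 2 (volume.restrict (Ω : Set Plane)))
    (h1 : MemLp (partialDeriv i f) 2 (volume.restrict (Ω : Set Plane))) :
    HasWeakPartial Ω i (h0.toLp f) (h1.toLp (partialDeriv i f)) := fun φ ↦ by
  have e0 : ∫ x in (Ω : Set Plane), h0.toLp f x * partialDeriv i φ x =
      ∫ x, f x * partialDeriv i φ x := by
    refine Eq.trans (integral_congr_ae ?_)
      (setIntegral_eq_integral_of_forall_compl_eq_zero fun x hx ↦ ?_)
    · filter_upwards [h0.coeFn_toLp] with x hx
      rw [hx]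
    · have hx' : x ∉ tsupport (fderiv ℝ φ) :=
        fun h ↦ hx (φ.tsupport_subset (tsupport_fderiv_subset ℝ h))
      rw [partialDeriv, image_eq_zero_of_notMem_tsupport hx']
      simp
  have e1 : ∫ x in (Ω : Set Plane), h1.toLp (partialDeriv i f) x * φ x =
      ∫ x, partialDeriv i f x * φ x := by
    refine Eq.trans (integral_congr_ae ?_)
      (setIntegral_eq_integral_of_forall_compl_eq_zero fun x hx ↦ ?_)
    · filter_upwards [h1.coeFn_toLp] with x hx
      rw [hx]
    · rw [image_eq_zero_of_notMem_tsupport fun h ↦ hx (φ.tsupport_subset h), mul_zero]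
  rw [e0, e1]
  have hc := (partialDeriv_apply_contDiff hf i).continuous
  refine integral_mul_fderiv_eq_neg_fderiv_mul_of_integrable ?_ ?_ ?_
    (fun x _ ↦ (hf.differentiable (by simp)) x) (fun x _ ↦ (φ.contDiff.differentiable (by simp)) x)
  · exact (hc.mul φ.continuous).integrable_of_hasCompactSupport φ.hasCompactSupport.mul_left
  · exact (hf.continuous.mul (partialDeriv_continuous i φ)).integrable_of_hasCompactSupport
      (φ.hasCompactSupport.fderiv_apply ℝ _).mul_left
  · exact (hf.continuous.mul φ.continuous).integrable_of_hasCompactSupport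
      φ.hasCompactSupport.mul_left

/-- The class in `L²(Ω)` of a continuous function, for bounded `Ω`. -/
noncomputable def contToL2 {Ω : Opens Plane} (hΩ : Bornology.IsBounded (Ω : Set Plane))
    {f : Plane → ℝ} (hf : Continuous f) : L2 Ω :=
  (memLp_of_continuous hΩ hf).toLp f

theorem coeFn_contToL2 {Ω : Opens Plane} (hΩ : Bornology.IsBounded (Ω : Set Plane))
    {f : Plane → ℝ} (hf : Continuous f) :
    contToL2 hΩ hf =ᵐ[volume.restrict (Ω : Set Plane)] f :=
  (memLp_of_continuous hΩ hf).coeFn_toLp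

theorem solvesHelmholtz_contToL2 {Ω : Opens Plane} (hΩ : Bornology.IsBounded (Ω : Set Plane))
    {f : Plane → ℝ} (hf : ContDiff ℝ (⊤ : ℕ∞) f) {lam : ℝ}
    (hlam : ∀ x, ∑ i, partialDeriv i (partialDeriv i f) x = -lam * f x) :
    SolvesHelmholtz Ω lam (contToL2 hΩ hf.continuous)
      (fun i ↦ contToL2 hΩ (partialDeriv_apply_contDiff hf i).continuous)
      (fun i j ↦ contToL2 hΩ
        (partialDeriv_apply_contDiff (partialDeriv_apply_contDiff hf i) j).continuous) where
  gradient i := hasWeakPartial_toLp hf i _ _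
  hessian i j := hasWeakPartial_toLp (partialDeriv_apply_contDiff hf i) j _ _
  helmholtz := by
    rw [Fin.sum_univ_two]
    refine Lp.ext ?_
    refine (Lp.coeFn_add _ _).trans ?_
    filter_upwards [Lp.coeFn_add (contToL2 hΩ
        (partialDeriv_apply_contDiff (partialDeriv_apply_contDiff hf 0) 0).continuous)
        (contToL2 hΩ (partialDeriv_apply_contDiff (partialDeriv_apply_contDiff hf 1) 1).continuous),
      Lp.coeFn_smul lam (contToL2 hΩ hf.continuous), coeFn_contToL2 hΩ hf.continuous,
      coeFn_contToL2 hΩ (partialDeriv_apply_contDiff (partialDeriv_apply_contDiff hf 0) 0).continuous,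
      coeFn_contToL2 hΩ (partialDeriv_apply_contDiff (partialDeriv_apply_contDiff hf 1) 1).continuous,
      Lp.coeFn_zero ℝ 2 (volume.restrict (Ω : Set Plane))] with x h1 h2 h3 h4 h5 h6
    have h := hlam x
    rw [Fin.sum_univ_two] at h
    rw [h6, Pi.add_apply, h1, h2, Pi.add_apply, Pi.smul_apply, h3, h4, h5, h]
    simp

/-! ### Orthogonality of eigenspaces -/

theorem SolvesHelmholtz.sum_hessian {Ω : Opens Plane} {lam : ℝ} {u : L2 Ω} {g : Fin 2 → L2 Ω}
    {h : Fin 2 → Fin 2 → L2 Ω} (H : SolvesHelmholtz Ω lam u g h) : ∑ i, h i i = -(lam • u) :=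
  eq_neg_of_add_eq_zero_left H.helmholtz

/-- Green's formula. For a test function it is the definition of the weak Hessian; both sides are
continuous in the H¹ norm, so it passes to the limits of test functions. -/
theorem SolvesHelmholtz.inner_gradient {Ω : Opens Plane} {lam : ℝ} {u u' : L2 Ω}
    {g g' : Fin 2 → L2 Ω} {h : Fin 2 → Fin 2 → L2 Ω} (H : SolvesHelmholtz Ω lam u g h)
    (D : DirichletCondition Ω u' g') : ∑ i, inner ℝ (g i) (g' i) = lam * inner ℝ u u' := by
  obtain ⟨φ, h0, h1⟩ := D
  have t0 : Tendsto (fun n ↦ (testFunction_memLp (φ n)).toLp (φ n)) atTop (𝓝 u') := by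
    rw [Lp.tendsto_Lp_iff_tendsto_eLpNorm' _ _]
    refine h0.congr fun n ↦ ?_
    rw [← eLpNorm_neg]
    refine eLpNorm_congr_ae ?_
    filter_upwards [(testFunction_memLp (φ n)).coeFn_toLp] with x hx
    simp [hx]
  have t1 (i : Fin 2) : Tendsto (fun n ↦ (partialDeriv_memLp i (φ n)).toLp (partialDeriv i (φ n)))
      atTop (𝓝 (g' i)) := by
    rw [Lp.tendsto_Lp_iff_tendsto_eLpNorm' _ _]
    refine (h1 i).congr fun n ↦ ?_
    rw [← eLpNorm_neg]
    refine eLpNorm_congr_ae ?_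
    filter_upwards [(partialDeriv_memLp i (φ n)).coeFn_toLp] with x hx
    simp [hx]
  have e (n : ℕ) : ∑ i, inner ℝ (g i) ((partialDeriv_memLp i (φ n)).toLp (partialDeriv i (φ n))) =
      lam * inner ℝ u ((testFunction_memLp (φ n)).toLp (φ n)) := by
    have e1 (i : Fin 2) : inner ℝ (g i) ((partialDeriv_memLp i (φ n)).toLp (partialDeriv i (φ n))) =
        -inner ℝ (h i i) ((testFunction_memLp (φ n)).toLp (φ n)) := by
      rw [inner_toLp, inner_toLp]
      exact H.hessian i i (φ n)
    simp_rw [e1]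
    rw [Finset.sum_neg_distrib, ← sum_inner, H.sum_hessian, inner_neg_left, neg_neg,
      real_inner_smul_left]
  refine tendsto_nhds_unique (tendsto_finsetSum _ fun i _ ↦ tendsto_const_nhds.inner (t1 i)) ?_
  simp_rw [e]
  exact (tendsto_const_nhds.inner t0).const_mul _

/-- The inner product of the gradients equals both lam⟨u, v⟩ and mu⟨u, v⟩. -/
theorem inner_dirichletEigenspace {Ω : Opens Plane} {lam mu : ℝ} (hne : lam ≠ mu) {u v : L2 Ω}
    (hu : u ∈ dirichletEigenspace Ω lam) (hv : v ∈ dirichletEigenspace Ω mu) : inner ℝ u v = 0 := by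
  obtain ⟨g, h, H, D⟩ := hu
  obtain ⟨g', h', H', D'⟩ := hv
  have e := H.inner_gradient D'
  have e' := H'.inner_gradient D
  simp_rw [real_inner_comm] at e e'
  have : (lam - mu) * inner ℝ u v = 0 := by
    have h1 : ∑ i, inner ℝ (g i) (g' i) = ∑ i, inner ℝ (g' i) (g i) :=
      Finset.sum_congr rfl fun i _ ↦ real_inner_comm _ _
    have h2 := real_inner_comm u v
    rw [h1] at e
    linarith
  exact (mul_eq_zero.1 this).resolve_left (sub_ne_zero.2 hne)

theorem inner_neumannEigenspace {Ω : Opens Plane} {lam mu : ℝ} (hne : lam ≠ mu) {u v : L2 Ω}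
    (hu : u ∈ neumannEigenspace Ω lam) (hv : v ∈ neumannEigenspace Ω mu) : inner ℝ u v = 0 := by
  obtain ⟨g, h, H, D⟩ := hu
  obtain ⟨g', h', H', D'⟩ := hv
  have e := D v g' H'.gradient
  have e' := D' u g H.gradient
  rw [H.sum_hessian, inner_neg_left, real_inner_smul_left] at e
  rw [H'.sum_hessian, inner_neg_left, real_inner_smul_left, real_inner_comm,
    Finset.sum_congr rfl fun i _ ↦ real_inner_comm _ _] at e'
  have : (lam - mu) * inner ℝ u v = 0 := by linarith
  exact (mul_eq_zero.1 this).resolve_left (sub_ne_zero.2 hne)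

/-! ### Cut-off functions -/

theorem exists_deriv_smoothTransition_bound :
    ∃ S, 0 ≤ S ∧ ∀ x, |deriv Real.smoothTransition x| ≤ S ∧
      (deriv Real.smoothTransition x ≠ 0 → 0 ≤ x ∧ x ≤ 1) := by
  have h0 : ∀ x, deriv Real.smoothTransition x ≠ 0 → x ∈ Set.Icc (0 : ℝ) 1 := by
    intro x hx
    refine ⟨?_, ?_⟩ <;> by_contra! hlt <;> apply hx
    · have : Real.smoothTransition =ᶠ[𝓝 x] fun _ ↦ 0 := by
        filter_upwards [eventually_lt_nhds hlt] with y hy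
        exact Real.smoothTransition.zero_of_nonpos hy.le
      rw [this.deriv_eq, deriv_const]
    · have : Real.smoothTransition =ᶠ[𝓝 x] fun _ ↦ 1 := by
        filter_upwards [eventually_gt_nhds hlt] with y hy
        exact Real.smoothTransition.one_of_one_le hy.le
      rw [this.deriv_eq, deriv_const]
  have hc : Continuous (deriv Real.smoothTransition) :=
    (Real.smoothTransition.contDiff (n := 1)).continuous_deriv le_rfl
  obtain ⟨S, hS⟩ := (isCompact_Icc (a := (0 : ℝ)) (b := 1)).exists_bound_of_continuousOn
    hc.continuousOn
  refine ⟨max S 0, le_max_right _ _, fun x ↦ ⟨?_, h0 x⟩⟩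
  by_cases hx : deriv Real.smoothTransition x = 0
  · rw [hx, abs_zero]
    exact le_max_right _ _
  · exact (hS x (h0 x hx)).trans (le_max_left _ _)

/-- A smooth function equal to `1` where all `p j` are at least `2 / n` and to `0` where some `p j`
is at most `1 / n`. -/
noncomputable def cutoff {ι : Type*} [Fintype ι] (p : ι → Plane → ℝ) (n : ℕ) (x : Plane) : ℝ :=
  ∏ j, Real.smoothTransition (n * p j x - 1)

section cutoff

variable {ι : Type*} [Fintype ι] {p : ι → Plane → ℝ}

theorem cutoff_contDiff (hp : ∀ j, ContDiff ℝ (⊤ : ℕ∞) (p j)) (n : ℕ) :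
    ContDiff ℝ (⊤ : ℕ∞) (cutoff p n) :=
  contDiff_prod fun j _ ↦ Real.smoothTransition.contDiff.comp
    ((contDiff_const.mul (hp j)).sub contDiff_const)

theorem abs_cutoff_le_one (n : ℕ) (x : Plane) : |cutoff p n x| ≤ 1 := by
  rw [cutoff, Finset.abs_prod]
  refine Finset.prod_le_one (fun _ _ ↦ abs_nonneg _) fun j _ ↦ ?_
  rw [abs_of_nonneg (Real.smoothTransition.nonneg _)]
  exact Real.smoothTransition.le_one _

theorem eventually_one_lt {x : Plane} (hx : ∀ j, 0 < p j x) :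
    ∀ᶠ n : ℕ in atTop, ∀ j, 1 < n * p j x - 1 := by
  refine eventually_all.2 fun j ↦ ?_
  have h := (tendsto_natCast_atTop_atTop (R := ℝ)).atTop_mul_const (hx j)
  filter_upwards [h.eventually_gt_atTop 2] with n hn
  linarith

theorem eventually_cutoff_eq_one {x : Plane} (hx : ∀ j, 0 < p j x) :
    ∀ᶠ n : ℕ in atTop, cutoff p n x = 1 := by
  filter_upwards [eventually_one_lt hx] with n hn
  exact Finset.prod_eq_one fun j _ ↦ Real.smoothTransition.one_of_one_le (hn j).le

theorem fderiv_cutoff [DecidableEq ι] (hp : ∀ j, ContDiff ℝ (⊤ : ℕ∞) (p j)) (n : ℕ)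
    (x v : Plane) : fderiv ℝ (cutoff p n) x v =
      ∑ j, (∏ k ∈ Finset.univ.erase j, Real.smoothTransition (n * p k x - 1)) *
        (deriv Real.smoothTransition (n * p j x - 1) * (n * fderiv ℝ (p j) x v)) := by
  have h (j : ι) : HasFDerivAt (fun x ↦ Real.smoothTransition (n * p j x - 1))
      (deriv Real.smoothTransition (n * p j x - 1) • ((n : ℝ) • fderiv ℝ (p j) x)) x := by
    have h1 : HasFDerivAt (fun x ↦ n * p j x - 1) ((n : ℝ) • fderiv ℝ (p j) x) x :=
      ((((hp j).differentiable (by simp)) x).hasFDerivAt.const_mul _).sub_const _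
    have h2 : HasDerivAt Real.smoothTransition (deriv Real.smoothTransition (n * p j x - 1))
        (n * p j x - 1) :=
      ((Real.smoothTransition.contDiff (n := 1)).differentiable (by simp) _).hasDerivAt
    exact h2.comp_hasFDerivAt x h1
  have h' := (HasFDerivAt.finsetProd (u := Finset.univ) fun j _ ↦ h j).fderiv
  have e : cutoff p n = fun x ↦ ∏ j, Real.smoothTransition (n * p j x - 1) := rfl
  rw [e, h']
  simp

/-- The derivative of the cut-off costs a factor n, but it is nonzero only where n · p j ≤ 2 for
some j, and there the bound C · p j on the directional derivative absorbs n. The resulting K is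
uniform in n, as dominated convergence requires. The direction v is f times a unit vector in the
Dirichlet case and the gradient of f in the Neumann case. -/
theorem exists_fderiv_cutoff_bound (hp : ∀ j, ContDiff ℝ (⊤ : ℕ∞) (p j)) (C : ℝ) :
    ∃ K, ∀ (n : ℕ) (x v : Plane), (∀ j, |fderiv ℝ (p j) x v| ≤ C * p j x) →
      (∀ j, 0 < p j x) → |fderiv ℝ (cutoff p n) x v| ≤ K := by
  classical
  obtain ⟨S, hS0, hS⟩ := exists_deriv_smoothTransition_bound
  refine ⟨∑ _j : ι, 2 * S * |C|, fun n x v hv hx ↦ ?_⟩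
  rw [fderiv_cutoff hp]
  refine (Finset.abs_sum_le_sum_abs _ _).trans (Finset.sum_le_sum fun j _ ↦ ?_)
  rw [abs_mul, Finset.abs_prod]
  have h1 : ∏ k ∈ Finset.univ.erase j, |Real.smoothTransition (n * p k x - 1)| ≤ 1 := by
    refine Finset.prod_le_one (fun _ _ ↦ abs_nonneg _) fun j _ ↦ ?_
    rw [abs_of_nonneg (Real.smoothTransition.nonneg _)]
    exact Real.smoothTransition.le_one _
  have h2 : |deriv Real.smoothTransition (n * p j x - 1) * (n * fderiv ℝ (p j) x v)| ≤
      2 * S * |C| := by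
    by_cases h0 : deriv Real.smoothTransition (n * p j x - 1) = 0
    · rw [h0, zero_mul, abs_zero]
      positivity
    · obtain ⟨-, h2⟩ := (hS _).2 h0
      rw [abs_mul, abs_mul, Nat.abs_cast]
      calc _ ≤ S * (n * (|C| * p j x)) := by
            gcongr
            · exact (hS _).1
            · exact (hv j).trans (mul_le_mul_of_nonneg_right (le_abs_self C) (hx j).le)
        _ = S * |C| * (n * p j x) := by ring
        _ ≤ S * |C| * 2 := by gcongr; linarith
        _ = _ := by ring
  exact (mul_le_of_le_one_left (abs_nonneg _) h1).trans h2

theorem eventually_fderiv_cutoff_eq_zero (hp : ∀ j, ContDiff ℝ (⊤ : ℕ∞) (p j)) {x : Plane}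
    (hx : ∀ j, 0 < p j x) (v : Plane) : ∀ᶠ n : ℕ in atTop, fderiv ℝ (cutoff p n) x v = 0 := by
  classical
  obtain ⟨S, -, hS⟩ := exists_deriv_smoothTransition_bound
  filter_upwards [eventually_one_lt hx] with n hn
  rw [fderiv_cutoff hp]
  refine Finset.sum_eq_zero fun j _ ↦ ?_
  have : deriv Real.smoothTransition (n * p j x - 1) = 0 := by
    by_contra h
    exact absurd ((hS _).2 h).2 (not_le.2 (hn j))
  rw [this]
  ring

theorem tsupport_cutoff_mul_subset (hp : ∀ j, ContDiff ℝ (⊤ : ℕ∞) (p j)) (n : ℕ) (f : Plane → ℝ) :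
    tsupport (fun x ↦ cutoff p n x * f x) ⊆ {x | ∀ j, 1 ≤ n * p j x} := by
  refine closure_minimal (fun x hx j ↦ ?_) ?_
  · by_contra! h
    refine hx ?_
    have : cutoff p n x = 0 := Finset.prod_eq_zero (Finset.mem_univ j)
      (Real.smoothTransition.zero_of_nonpos (by linarith))
    simp only [this, zero_mul]
  · simp only [Set.ofPred_forall]
    exact isClosed_iInter fun j ↦ isClosed_le continuous_const
      (continuous_const.mul (hp j).continuous)

/-- The product of a cut-off function and a smooth function, as a test function. -/
noncomputable def cutoffMul {Ω : Opens Plane} (hΩ : Bornology.IsBounded (Ω : Set Plane))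
    (hp : ∀ j, ContDiff ℝ (⊤ : ℕ∞) (p j)) (hΩp : ∀ x, x ∈ Ω ↔ ∀ j, 0 < p j x) (n : ℕ)
    {f : Plane → ℝ} (hf : ContDiff ℝ (⊤ : ℕ∞) f) : 𝓓(Ω, ℝ) where
  toFun x := cutoff p n x * f x
  contDiff' := (cutoff_contDiff hp n).mul hf
  tsupport_subset' := fun x hx ↦ (hΩp x).2 fun j ↦ by
    have := tsupport_cutoff_mul_subset hp n f hx j
    exact pos_of_mul_pos_right (by linarith) (Nat.cast_nonneg n)
  hasCompactSupport' := by
    refine Metric.isCompact_of_isClosed_isBounded (isClosed_tsupport _) (hΩ.subset fun x hx ↦ ?_)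
    refine (hΩp x).2 fun j ↦ ?_
    have := tsupport_cutoff_mul_subset hp n f hx j
    exact pos_of_mul_pos_right (by linarith) (Nat.cast_nonneg n)

theorem partialDeriv_cutoffMul {Ω : Opens Plane} (hΩ : Bornology.IsBounded (Ω : Set Plane))
    (hp : ∀ j, ContDiff ℝ (⊤ : ℕ∞) (p j)) (hΩp : ∀ x, x ∈ Ω ↔ ∀ j, 0 < p j x) (n : ℕ)
    {f : Plane → ℝ} (hf : ContDiff ℝ (⊤ : ℕ∞) f) (i : Fin 2) (x : Plane) :
    partialDeriv i (cutoffMul hΩ hp hΩp n hf) x =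
      cutoff p n x * partialDeriv i f x +
        fderiv ℝ (cutoff p n) x (f x • EuclideanSpace.single i 1) := by
  have h1 := ((cutoff_contDiff hp n).differentiable (by simp)) x
  have h2 := (hf.differentiable (by simp)) x
  have e : (cutoffMul hΩ hp hΩp n hf : Plane → ℝ) = fun x ↦ cutoff p n x * f x := rfl
  rw [partialDeriv, e, fderiv_fun_mul h1 h2]
  simp [partialDeriv]

end cutoff

theorem tendsto_eLpNorm_two_of_bounded {α : Type*} [MeasurableSpace α] {μ : Measure α}
    [IsFiniteMeasure μ] {F : ℕ → α → ℝ} {K : ℝ} (hm : ∀ n, AEStronglyMeasurable (F n) μ)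
    (hb : ∀ n, ∀ᵐ x ∂μ, |F n x| ≤ K) (hl : ∀ᵐ x ∂μ, Tendsto (fun n ↦ F n x) atTop (𝓝 0)) :
    Tendsto (fun n ↦ eLpNorm (F n) 2 μ) atTop (𝓝 0) := by
  have h : Tendsto (fun n ↦ ∫⁻ x, ‖F n x‖ₑ ^ 2 ∂μ) atTop (𝓝 (∫⁻ _, 0 ∂μ)) := by
    refine tendsto_lintegral_of_dominated_convergence' (fun _ ↦ ENNReal.ofReal K ^ 2)
      (fun n ↦ (hm n).enorm.pow_const 2) (fun n ↦ ?_) ?_ ?_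
    · filter_upwards [hb n] with x hx
      gcongr
      rw [← ofReal_norm]
      exact ENNReal.ofReal_le_ofReal hx
    · rw [lintegral_const]
      exact ENNReal.mul_ne_top (by simp) (measure_ne_top _ _)
    · filter_upwards [hl] with x hx
      have := (ENNReal.continuous_pow 2).tendsto _ |>.comp (hx.enorm)
      simpa [Function.comp_def] using this
  have h2 := (ENNReal.continuous_rpow_const (y := 1 / 2)).tendsto _ |>.comp h
  simp only [lintegral_zero, Function.comp_def] at h2
  rw [ENNReal.zero_rpow_of_pos (by norm_num)] at h2
  refine h2.congr fun n ↦ ?_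
  rw [eLpNorm_eq_lintegral_rpow_enorm_toReal (by norm_num) (by norm_num)]
  simp

/-! ### Boundary conditions for smooth functions on a polygon. -/

section polygon

variable {ι : Type*} [Fintype ι] {p : ι → Plane → ℝ} {Ω : Opens Plane}

theorem isFiniteMeasure_restrict_of_isBounded (hΩ : Bornology.IsBounded (Ω : Set Plane)) :
    IsFiniteMeasure (volume.restrict (Ω : Set Plane)) :=
  ⟨by rw [Measure.restrict_apply_univ]; exact hΩ.measure_lt_top⟩

theorem exists_bound_of_isBounded (hΩ : Bornology.IsBounded (Ω : Set Plane)) {f : Plane → ℝ}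
    (hf : Continuous f) : ∃ M, ∀ x ∈ Ω, |f x| ≤ M := by
  obtain ⟨M, hM⟩ := hΩ.isCompact_closure.exists_bound_of_continuousOn hf.continuousOn
  exact ⟨M, fun x hx ↦ hM x (subset_closure hx)⟩

/-- A smooth function which vanishes at least linearly at all sides of a polygon belongs to
`H¹₀`. -/
theorem dirichletCondition_contToL2 (hΩ : Bornology.IsBounded (Ω : Set Plane))
    (hp : ∀ j, ContDiff ℝ (⊤ : ℕ∞) (p j)) (hΩp : ∀ x, x ∈ Ω ↔ ∀ j, 0 < p j x)
    {f : Plane → ℝ} (hf : ContDiff ℝ (⊤ : ℕ∞) f) {C : ℝ}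
    (hC : ∀ x ∈ Ω, ∀ i j, |f x * partialDeriv i (p j) x| ≤ C * p j x) :
    DirichletCondition Ω (contToL2 hΩ hf.continuous)
      (fun i ↦ contToL2 hΩ (partialDeriv_apply_contDiff hf i).continuous) := by
  have := isFiniteMeasure_restrict_of_isBounded hΩ
  obtain ⟨K, hK⟩ := exists_fderiv_cutoff_bound hp C
  refine ⟨fun n ↦ cutoffMul hΩ hp hΩp n hf, ?_, fun i ↦ ?_⟩
  · obtain ⟨M, hM⟩ := exists_bound_of_isBounded hΩ hf.continuous
    refine tendsto_eLpNorm_two_of_bounded (K := M + M) (fun n ↦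
      (Lp.aestronglyMeasurable _).sub (testFunction_memLp _).1) (fun n ↦ ?_) ?_
    · filter_upwards [coeFn_contToL2 hΩ hf.continuous, ae_restrict_mem Ω.isOpen.measurableSet]
        with x hx hxΩ
      rw [hx]
      refine (abs_sub _ _).trans (add_le_add (hM x hxΩ) ?_)
      change |cutoff p n x * f x| ≤ M
      rw [abs_mul]
      exact (mul_le_of_le_one_left (abs_nonneg _) (abs_cutoff_le_one n x)).trans (hM x hxΩ)
    · filter_upwards [coeFn_contToL2 hΩ hf.continuous, ae_restrict_mem Ω.isOpen.measurableSet]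
        with x hx hxΩ
      refine tendsto_const_nhds.congr' ?_
      filter_upwards [eventually_cutoff_eq_one ((hΩp x).1 hxΩ)] with n hn
      change 0 = _ - cutoff p n x * f x
      rw [hx, hn, one_mul, sub_self]
  · have hfi := (partialDeriv_apply_contDiff hf i).continuous
    obtain ⟨M, hM⟩ := exists_bound_of_isBounded hΩ hfi
    refine tendsto_eLpNorm_two_of_bounded (K := M + (M + K)) (fun n ↦
      (Lp.aestronglyMeasurable _).sub (partialDeriv_memLp i _).1) (fun n ↦ ?_) ?_
    · filter_upwards [coeFn_contToL2 hΩ hfi, ae_restrict_mem Ω.isOpen.measurableSet] with x hx hxΩ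
      rw [hx, partialDeriv_cutoffMul]
      refine (abs_sub _ _).trans (add_le_add (hM x hxΩ) ((abs_add_le _ _).trans (add_le_add ?_ ?_)))
      · rw [abs_mul]
        exact (mul_le_of_le_one_left (abs_nonneg _) (abs_cutoff_le_one n x)).trans (hM x hxΩ)
      · refine hK n x _ (fun j ↦ ?_) ((hΩp x).1 hxΩ)
        rw [map_smul]
        exact hC x hxΩ i j
    · filter_upwards [coeFn_contToL2 hΩ hfi, ae_restrict_mem Ω.isOpen.measurableSet] with x hx hxΩ
      refine tendsto_const_nhds.congr' ?_
      filter_upwards [eventually_cutoff_eq_one ((hΩp x).1 hxΩ),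
        eventually_fderiv_cutoff_eq_zero hp ((hΩp x).1 hxΩ) (f x • EuclideanSpace.single i 1)]
        with n hn hn'
      rw [hx, partialDeriv_cutoffMul, hn, hn', one_mul, add_zero, sub_self]

theorem tendsto_integral_mul_of_bounded (hΩ : Bornology.IsBounded (Ω : Set Plane)) (w : L2 Ω)
    {F : ℕ → Plane → ℝ} {f : Plane → ℝ} {K : ℝ} (hF : ∀ n, Continuous (F n))
    (hb : ∀ n, ∀ x ∈ Ω, |F n x| ≤ K) (hl : ∀ x ∈ Ω, ∀ᶠ n in atTop, F n x = f x) :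
    Tendsto (fun n ↦ ∫ x in (Ω : Set Plane), w x * F n x) atTop
      (𝓝 (∫ x in (Ω : Set Plane), w x * f x)) := by
  have := isFiniteMeasure_restrict_of_isBounded hΩ
  have hw : Integrable w (volume.restrict (Ω : Set Plane)) :=
    (Lp.memLp w).integrable (by norm_num)
  refine tendsto_integral_of_dominated_convergence (fun x ↦ |w x| * K)
    (fun n ↦ (Lp.aestronglyMeasurable w).mul (hF n).aestronglyMeasurable) (hw.abs.mul_const K)
    (fun n ↦ ?_) ?_
  · filter_upwards [ae_restrict_mem Ω.isOpen.measurableSet] with x hx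
    rw [norm_mul]
    exact mul_le_mul_of_nonneg_left (hb n x hx) (abs_nonneg _)
  · filter_upwards [ae_restrict_mem Ω.isOpen.measurableSet] with x hx
    refine tendsto_const_nhds.congr' ?_
    filter_upwards [hl x hx] with n hn
    rw [hn]

/-- A smooth function on a polygon whose normal derivative vanishes at least linearly at all sides
satisfies the Neumann condition. -/
theorem neumannCondition_contToL2 (hΩ : Bornology.IsBounded (Ω : Set Plane))
    (hp : ∀ j, ContDiff ℝ (⊤ : ℕ∞) (p j)) (hΩp : ∀ x, x ∈ Ω ↔ ∀ j, 0 < p j x)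
    {f : Plane → ℝ} (hf : ContDiff ℝ (⊤ : ℕ∞) f) {C : ℝ}
    (hC : ∀ x ∈ Ω, ∀ j, |∑ i, partialDeriv i f x * partialDeriv i (p j) x| ≤ C * p j x) :
    NeumannCondition Ω (fun i ↦ contToL2 hΩ (partialDeriv_apply_contDiff hf i).continuous)
      (fun i j ↦ contToL2 hΩ
        (partialDeriv_apply_contDiff (partialDeriv_apply_contDiff hf i) j).continuous) := by
  intro v dv hv
  obtain ⟨K, hK⟩ := exists_fderiv_cutoff_bound hp C
  have hf1 := partialDeriv_apply_contDiff hf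
  have hf2 := fun i ↦ partialDeriv_apply_contDiff (hf1 i) i
  set W : Plane → Plane := fun x ↦ ∑ i, partialDeriv i f x • EuclideanSpace.single i (1 : ℝ) with hW
  set L : Plane → ℝ := fun x ↦ ∑ i, partialDeriv i (partialDeriv i f) x with hL
  have hWc : Continuous W := continuous_finsetSum _ fun i _ ↦ (hf1 i).continuous.smul continuous_const
  have hLc : Continuous L := continuous_finsetSum _ fun i _ ↦ (hf2 i).continuous
  have hdc (n : ℕ) : Continuous fun x ↦ fderiv ℝ (cutoff p n) x (W x) :=
    ((cutoff_contDiff hp n).continuous_fderiv (by simp)).clm_apply hWc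
  have hcc (n : ℕ) := (cutoff_contDiff hp n).continuous
  -- The weak derivative of v is tested against the cut-off gradient of f; `W` is that gradient and
  -- `L` the Laplacian. The second integral, where the derivative falls on the cut-off, represents
  -- the boundary term and tends to 0.
  have key (n : ℕ) : (∫ x in (Ω : Set Plane), v x * (cutoff p n x * L x)) +
      (∫ x in (Ω : Set Plane), v x * fderiv ℝ (cutoff p n) x (W x)) =
      -∑ i, ∫ x in (Ω : Set Plane), dv i x * (cutoff p n x * partialDeriv i f x) := by
    have hv1 : ∀ {G : Plane → ℝ}, Continuous G →
        Integrable (fun x ↦ v x * G x) (volume.restrict (Ω : Set Plane)) := fun hG ↦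
      (Lp.memLp v).integrable_mul (memLp_of_continuous hΩ hG)
    have e (i : Fin 2) := hv i (cutoffMul hΩ hp hΩp n (hf1 i))
    rw [← Finset.sum_neg_distrib]
    have e' (i : Fin 2) : -∫ x in (Ω : Set Plane), dv i x * (cutoff p n x * partialDeriv i f x) =
      ∫ x in (Ω : Set Plane), v x * partialDeriv i (cutoffMul hΩ hp hΩp n (hf1 i)) x := (e i).symm
    simp_rw [e']
    rw [← integral_add (hv1 (G := fun x ↦ cutoff p n x * L x) ((hcc n).mul hLc)) (hv1 (hdc n)), ← integral_finsetSum _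
      fun i _ ↦ hv1 (partialDeriv_continuous i _)]
    refine integral_congr_ae (Eventually.of_forall fun x ↦ ?_)
    simp only [partialDeriv_cutoffMul, hL, hW, map_sum, Finset.mul_sum, mul_add,
      Finset.sum_add_distrib]
  obtain ⟨M, hM⟩ := exists_bound_of_isBounded hΩ hLc
  have t1 := tendsto_integral_mul_of_bounded hΩ v (F := fun n x ↦ cutoff p n x * L x) (f := L)
    (K := M) (fun n ↦ (hcc n).mul hLc) (fun n x hx ↦ by
      rw [abs_mul]
      exact (mul_le_of_le_one_left (abs_nonneg _) (abs_cutoff_le_one n x)).trans (hM x hx))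
    (fun x hx ↦ (eventually_cutoff_eq_one ((hΩp x).1 hx)).mono fun n hn ↦ by
      simp only [hn, one_mul])
  have t2 := tendsto_integral_mul_of_bounded hΩ v
    (F := fun n x ↦ fderiv ℝ (cutoff p n) x (W x)) (f := fun _ ↦ 0) (K := K) hdc
    (fun n x hx ↦ hK n x _ (fun j ↦ by
      simp only [hW, map_sum, map_smul, smul_eq_mul]
      exact hC x hx j) ((hΩp x).1 hx))
    (fun x hx ↦ eventually_fderiv_cutoff_eq_zero hp ((hΩp x).1 hx) _)
  have t3 (i : Fin 2) : Tendsto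
      (fun n ↦ ∫ x in (Ω : Set Plane), dv i x * (cutoff p n x * partialDeriv i f x)) atTop
      (𝓝 (∫ x in (Ω : Set Plane), dv i x * partialDeriv i f x)) := by
    obtain ⟨M, hM⟩ := exists_bound_of_isBounded hΩ (hf1 i).continuous
    exact tendsto_integral_mul_of_bounded hΩ (dv i) (K := M)
      (fun n ↦ (hcc n).mul (hf1 i).continuous) (fun n x hx ↦ by
        rw [abs_mul]
        exact (mul_le_of_le_one_left (abs_nonneg _) (abs_cutoff_le_one n x)).trans (hM x hx))
      (fun x hx ↦ (eventually_cutoff_eq_one ((hΩp x).1 hx)).mono fun n hn ↦ by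
        simp only [hn, one_mul])
  have hlim := tendsto_nhds_unique ((t1.add t2).congr key) (tendsto_finsetSum _ fun i _ ↦ t3 i).neg
  have hv1 : ∀ {G : Plane → ℝ}, Continuous G →
      Integrable (fun x ↦ v x * G x) (volume.restrict (Ω : Set Plane)) := fun hG ↦
    (Lp.memLp v).integrable_mul (memLp_of_continuous hΩ hG)
  have eL : ∫ x in (Ω : Set Plane), v x * L x =
      ∑ i, ∫ x in (Ω : Set Plane), v x * partialDeriv i (partialDeriv i f) x := by
    rw [← integral_finsetSum _ fun i _ ↦ hv1 (hf2 i).continuous]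
    simp only [hL, Finset.mul_sum]
  simp only [mul_zero, integral_zero, add_zero] at hlim
  rw [eL] at hlim
  rw [sum_inner]
  have i1 (i : Fin 2) : inner ℝ (contToL2 hΩ (hf1 i).continuous) (dv i) =
      ∫ x in (Ω : Set Plane), dv i x * partialDeriv i f x := by
    rw [real_inner_comm, contToL2, inner_toLp]
  have i2 (i : Fin 2) : inner ℝ (contToL2 hΩ (hf2 i).continuous) v =
      ∫ x in (Ω : Set Plane), v x * partialDeriv i (partialDeriv i f) x := by
    rw [real_inner_comm, contToL2, inner_toLp]
  simp only [i1, i2]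
  linarith

end polygon

/-! ### Trigonometric eigenfunctions -/

/-- The reflections at the three sides of the triangle, acting on the hexagonal lattice. -/
def hexRefl (j : Fin 3) (k : ℤ × ℤ) : ℤ × ℤ :=
  ![(k.1, k.1 - k.2), (k.2, k.1), (-k.1, k.2 - k.1)] j

/-- Left multiplication by `hexRefl j` on the index set of `hexAct`. -/
def hexReflMul (j : Fin 3) : Fin 12 → Fin 12 :=
  ![![7, 8, 9, 10, 11, 6, 5, 0, 1, 2, 3, 4], ![6, 7, 8, 9, 10, 11, 0, 1, 2, 3, 4, 5],
    ![10, 11, 6, 7, 8, 9, 2, 3, 4, 5, 0, 1]] j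

theorem hexReflMul_involutive (j : Fin 3) : Function.Involutive (hexReflMul j) := by
  intro g
  revert j g
  decide

theorem hexAct_hexReflMul (j : Fin 3) (g : Fin 12) (k : ℤ × ℤ) :
    hexAct (hexReflMul j g) k = hexRefl j (hexAct g k) := by
  fin_cases j <;> fin_cases g <;> simp [hexReflMul, hexRefl, hexAct] <;> omega

/-- The character of the dihedral group which is `1` on rotations and `s` on reflections. -/
def hexSign (s : ℝ) (g : Fin 12) : ℝ := if g < 6 then 1 else s

theorem hexSign_hexReflMul {s : ℝ} (hs : s * s = 1) (j : Fin 3) (g : Fin 12) :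
    hexSign s (hexReflMul j g) = s * hexSign s g := by
  have h : (hexReflMul j g < 6) ↔ ¬ (g < 6) := by
    revert j g
    decide
  rw [hexSign, hexSign]
  by_cases hg : g < 6
  · rw [if_neg (by tauto), if_pos hg, mul_one]
  · rw [if_pos (by tauto), if_neg hg, hs]

theorem abs_hexSign {s : ℝ} (hs : s * s = 1) (g : Fin 12) : |hexSign s g| = 1 := by
  rw [hexSign]
  split_ifs
  · simp
  · rcases mul_self_eq_one_iff.1 hs with h | h <;> simp [h]

/-- The component of a lattice vector orthogonal to the side `j`. -/
def sideCoeff (j : Fin 3) (k : ℤ × ℤ) : ℤ := ![2 * k.2 - k.1, k.1 - k.2, -k.1] j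

theorem sideCoeff_hexRefl (j : Fin 3) (k : ℤ × ℤ) :
    sideCoeff j (hexRefl j k) = -sideCoeff j k := by
  fin_cases j <;> simp [sideCoeff, hexRefl]
  ring

theorem partialDeriv_eq_of_hasFDerivAt {f : Plane → ℝ} {x w : Plane}
    (h : HasFDerivAt f (innerSL ℝ w) x) (i : Fin 2) : partialDeriv i f x = w i := by
  rw [partialDeriv, h.fderiv, innerSL_apply_apply]
  simp [EuclideanSpace.inner_single_right]

/-- Two vectors `va`, `vb` of the same length at an angle of `2π/3`: the gradients of the
coordinates in which the group generated by the reflections at the sides of the triangle acts by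
integer affine maps. -/
structure HexFrame where
  origin : Plane
  va : Plane
  vb : Plane
  size : ℝ
  size_pos : 0 < size
  inner_va_va : inner ℝ va va = 4 / (9 * size ^ 2)
  inner_vb_vb : inner ℝ vb vb = 4 / (9 * size ^ 2)
  inner_va_vb : inner ℝ va vb = -2 / (9 * size ^ 2)

namespace HexFrame

variable (F : HexFrame)

/-- First coordinate. -/
noncomputable def fstCoord (x : Plane) : ℝ := inner ℝ F.va (x - F.origin)

/-- Second coordinate. -/
noncomputable def sndCoord (x : Plane) : ℝ := inner ℝ F.vb (x - F.origin)

/-- The wave vector of a point of the dual lattice. -/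
noncomputable def wave (k : ℤ × ℤ) : Plane :=
  (2 * Real.pi) • ((k.1 : ℝ) • F.va + (k.2 : ℝ) • F.vb)

/-- The frequency of a point of the dual lattice. -/
noncomputable def freq (k : ℤ × ℤ) : ℝ := 16 * Real.pi ^ 2 / (9 * F.size ^ 2) * hexForm k

theorem inner_wave_sub (k : ℤ × ℤ) (x : Plane) : inner ℝ (F.wave k) (x - F.origin) =
    2 * Real.pi * (k.1 * F.fstCoord x + k.2 * F.sndCoord x) := by
  simp only [wave, fstCoord, sndCoord, real_inner_smul_left, inner_add_left]

theorem inner_wave_self (k : ℤ × ℤ) : inner ℝ (F.wave k) (F.wave k) = F.freq k := by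
  have hs := F.size_pos.ne'
  simp only [wave, freq, real_inner_smul_left, real_inner_smul_right, inner_add_left,
    inner_add_right, F.inner_va_va, F.inner_vb_vb, F.inner_va_vb,
    (real_inner_comm F.va F.vb).trans F.inner_va_vb, hexForm]
  push_cast
  field_simp
  ring

/-- The inner normal vectors of the sides of the triangle. -/
noncomputable def normal (j : Fin 3) : Plane :=
  ![F.vb, F.va - F.vb, -((2 : ℝ) • F.va + F.vb)] j

/-- The affine functions defining the sides of the triangle. -/
noncomputable def side (j : Fin 3) (x : Plane) : ℝ :=
  inner ℝ (F.normal j) (x - F.origin) + ![0, 0, 1] j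

theorem side_eq (j : Fin 3) (x : Plane) : F.side j x =
    ![F.sndCoord x, F.fstCoord x - F.sndCoord x, 1 - 2 * F.fstCoord x - F.sndCoord x] j := by
  fin_cases j
  · simp [side, normal, sndCoord]
  · simp [side, normal, fstCoord, sndCoord, inner_sub_left]
  · simp only [side, normal, fstCoord, sndCoord]
    simp only [Fin.reduceFinMk, Matrix.cons_val, inner_neg_left, inner_add_left,
      real_inner_smul_left]
    ring

theorem hasFDerivAt_inner_sub (w x : Plane) :
    HasFDerivAt (fun x ↦ inner ℝ w (x - F.origin)) (innerSL ℝ w) x := by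
  have := (innerSL ℝ w).hasFDerivAt.comp x ((hasFDerivAt_id x).sub_const F.origin)
  exact this

theorem contDiff_inner_sub (w : Plane) :
    ContDiff ℝ (⊤ : ℕ∞) (fun x ↦ inner ℝ w (x - F.origin)) :=
  (innerSL ℝ w).contDiff.comp (contDiff_id.sub contDiff_const)

theorem side_contDiff (j : Fin 3) : ContDiff ℝ (⊤ : ℕ∞) (F.side j) :=
  (F.contDiff_inner_sub _).add contDiff_const

theorem partialDeriv_side (j : Fin 3) (i : Fin 2) (x : Plane) :
    partialDeriv i (F.side j) x = F.normal j i :=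
  partialDeriv_eq_of_hasFDerivAt ((F.hasFDerivAt_inner_sub _ x).add_const _) i

theorem inner_wave_normal (j : Fin 3) (k : ℤ × ℤ) :
    inner ℝ (F.wave k) (F.normal j) =
      4 * Real.pi / (9 * F.size ^ 2) * ![1, 3, 3] j * sideCoeff j k := by
  have hs := F.size_pos.ne'
  have hba := (real_inner_comm F.va F.vb).trans F.inner_va_vb
  have haa := (real_inner_self_eq_norm_sq F.va).symm.trans F.inner_va_va
  have hbb := (real_inner_self_eq_norm_sq F.vb).symm.trans F.inner_vb_vb
  fin_cases j <;>
  simp [wave, normal, sideCoeff, real_inner_smul_left, real_inner_smul_right, inner_add_left,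
    inner_add_right, inner_sub_right, haa, hbb, F.inner_va_vb, hba] <;>
  field_simp <;> ring

/-- The phases at a lattice point and at its reflection differ by a multiple of the side
function, up to periods. -/
theorem inner_wave_hexRefl (j : Fin 3) (k : ℤ × ℤ) (x : Plane) :
    ∃ N : ℤ, inner ℝ (F.wave k) (x - F.origin) =
      inner ℝ (F.wave (hexRefl j k)) (x - F.origin) + N * (2 * Real.pi) +
        2 * Real.pi * sideCoeff j k * F.side j x := by
  -- Two sides pass through the origin, so their reflections are linear; the reflection in the third
  -- is affine and shifts the phase by `k.1` periods.
  refine ⟨![0, 0, k.1] j, ?_⟩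
  rw [inner_wave_sub, inner_wave_sub, side_eq]
  fin_cases j <;> simp [hexRefl, sideCoeff] <;> ring

theorem abs_cos_sub_cos_hexRefl_le (j : Fin 3) (k : ℤ × ℤ) {x : Plane} (hx : 0 ≤ F.side j x) :
    |Real.cos (inner ℝ (F.wave k) (x - F.origin)) -
      Real.cos (inner ℝ (F.wave (hexRefl j k)) (x - F.origin))| ≤
      2 * Real.pi * |(sideCoeff j k : ℝ)| * F.side j x := by
  obtain ⟨N, hN⟩ := F.inner_wave_hexRefl j k x
  rw [← Real.cos_add_int_mul_two_pi (inner ℝ (F.wave (hexRefl j k)) (x - F.origin)) N]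
  refine (Real.abs_cos_sub_cos_le _ _).trans (le_of_eq ?_)
  rw [hN, add_sub_cancel_left, abs_mul, abs_mul, abs_of_nonneg hx, abs_of_pos Real.two_pi_pos]

theorem abs_sin_sub_sin_hexRefl_le (j : Fin 3) (k : ℤ × ℤ) {x : Plane} (hx : 0 ≤ F.side j x) :
    |Real.sin (inner ℝ (F.wave k) (x - F.origin)) -
      Real.sin (inner ℝ (F.wave (hexRefl j k)) (x - F.origin))| ≤
      2 * Real.pi * |(sideCoeff j k : ℝ)| * F.side j x := by
  obtain ⟨N, hN⟩ := F.inner_wave_hexRefl j k x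
  rw [← Real.sin_add_int_mul_two_pi (inner ℝ (F.wave (hexRefl j k)) (x - F.origin)) N]
  refine (Real.abs_sin_sub_sin_le _ _).trans (le_of_eq ?_)
  rw [hN, add_sub_cancel_left, abs_mul, abs_mul, abs_of_nonneg hx, abs_of_pos Real.two_pi_pos]

/-- The (anti)symmetrization of a plane wave under the dihedral group. -/
noncomputable def eigenfun (s : ℝ) (k : ℤ × ℤ) (x : Plane) : ℝ :=
  ∑ g, hexSign s g * Real.cos (inner ℝ (F.wave (hexAct g k)) (x - F.origin))

theorem eigenfun_contDiff (s : ℝ) (k : ℤ × ℤ) : ContDiff ℝ (⊤ : ℕ∞) (F.eigenfun s k) :=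
  ContDiff.sum fun _ _ ↦ contDiff_const.mul (F.contDiff_inner_sub _).cos

theorem partialDeriv_eigenfun (s : ℝ) (k : ℤ × ℤ) (i : Fin 2) (x : Plane) :
    partialDeriv i (F.eigenfun s k) x = ∑ g, -(hexSign s g * (F.wave (hexAct g k)) i) *
      Real.sin (inner ℝ (F.wave (hexAct g k)) (x - F.origin)) := by
  have h : HasFDerivAt (F.eigenfun s k) (innerSL ℝ (∑ g,
      -(hexSign s g * Real.sin (inner ℝ (F.wave (hexAct g k)) (x - F.origin))) •
        F.wave (hexAct g k))) x := by
    rw [map_sum]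
    refine HasFDerivAt.fun_sum fun g _ ↦ ?_
    refine ((F.hasFDerivAt_inner_sub (F.wave (hexAct g k)) x).cos.const_mul
      (hexSign s g)).congr_fderiv ?_
    rw [map_smul, smul_smul]
    congr 1
    ring
  rw [partialDeriv_eq_of_hasFDerivAt h]
  simp only [WithLp.ofLp_sum, Finset.sum_apply, PiLp.smul_apply, smul_eq_mul]
  exact Finset.sum_congr rfl fun g _ ↦ by ring

theorem partialDeriv_partialDeriv_eigenfun (s : ℝ) (k : ℤ × ℤ) (i : Fin 2) (x : Plane) :
    partialDeriv i (partialDeriv i (F.eigenfun s k)) x =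
      ∑ g, -(hexSign s g * (F.wave (hexAct g k)) i * (F.wave (hexAct g k)) i) *
      Real.cos (inner ℝ (F.wave (hexAct g k)) (x - F.origin)) := by
  rw [show partialDeriv i (F.eigenfun s k) = _ from funext (F.partialDeriv_eigenfun s k i)]
  have h : HasFDerivAt (fun x ↦ ∑ g, -(hexSign s g * (F.wave (hexAct g k)) i) *
      Real.sin (inner ℝ (F.wave (hexAct g k)) (x - F.origin))) (innerSL ℝ (∑ g,
      -(hexSign s g * (F.wave (hexAct g k)) i *
        Real.cos (inner ℝ (F.wave (hexAct g k)) (x - F.origin))) • F.wave (hexAct g k))) x := by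
    rw [map_sum]
    refine HasFDerivAt.fun_sum fun g _ ↦ ?_
    refine ((F.hasFDerivAt_inner_sub (F.wave (hexAct g k)) x).sin.const_mul
      (-(hexSign s g * (F.wave (hexAct g k)) i))).congr_fderiv ?_
    rw [map_smul, smul_smul]
    congr 1
    ring
  rw [partialDeriv_eq_of_hasFDerivAt h]
  simp only [WithLp.ofLp_sum, Finset.sum_apply, PiLp.smul_apply, smul_eq_mul]
  exact Finset.sum_congr rfl fun g _ ↦ by ring

theorem real_inner_eq_sum (v w : Plane) : inner ℝ v w = ∑ i, v i * w i := by
  rw [PiLp.inner_apply]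
  exact Finset.sum_congr rfl fun i _ ↦ by simp [mul_comm]

theorem freq_hexAct (g : Fin 12) (k : ℤ × ℤ) : F.freq (hexAct g k) = F.freq k := by
  rw [freq, hexForm_hexAct, freq]

theorem laplacian_eigenfun (s : ℝ) (k : ℤ × ℤ) (x : Plane) :
    ∑ i, partialDeriv i (partialDeriv i (F.eigenfun s k)) x = -F.freq k * F.eigenfun s k x := by
  simp only [partialDeriv_partialDeriv_eigenfun]
  rw [Finset.sum_comm, eigenfun, Finset.mul_sum]
  refine Finset.sum_congr rfl fun g _ ↦ ?_
  rw [← F.freq_hexAct g, ← F.inner_wave_self, real_inner_eq_sum (F.wave _) (F.wave _)]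
  simp only [Fin.sum_univ_two]
  ring

theorem two_mul_sum_eq (j : Fin 3) (f : Fin 12 → ℝ) :
    2 * ∑ g, f g = ∑ g, (f g + f (hexReflMul j g)) := by
  have h : ∑ g, f (hexReflMul j g) = ∑ g, f g :=
    Equiv.sum_comp (hexReflMul_involutive j).toPerm f
  rw [Finset.sum_add_distrib, h, two_mul]

/-- Terms paired by the reflection in side j have opposite signs and, modulo 2π, phases that agree
on the side; the cosine is Lipschitz. -/
theorem abs_eigenfun_le (k : ℤ × ℤ) (j : Fin 3) {x : Plane} (hx : 0 ≤ F.side j x) :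
    |F.eigenfun (-1) k x| ≤
      (∑ g, 2 * Real.pi * |(sideCoeff j (hexAct g k) : ℝ)|) * F.side j x := by
  have h2 : 2 * |F.eigenfun (-1) k x| ≤
      (∑ g, 2 * Real.pi * |(sideCoeff j (hexAct g k) : ℝ)|) * F.side j x := by
    rw [← abs_two, ← abs_mul, abs_two, eigenfun, two_mul_sum_eq j, Finset.sum_mul]
    refine (Finset.abs_sum_le_sum_abs _ _).trans (Finset.sum_le_sum fun g _ ↦ ?_)
    refine le_trans (le_of_eq ?_) (F.abs_cos_sub_cos_hexRefl_le j (hexAct g k) hx)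
    rw [hexSign_hexReflMul (by norm_num), hexAct_hexReflMul, neg_one_mul, neg_mul,
      ← sub_eq_add_neg, ← mul_sub, abs_mul, abs_hexSign (by norm_num), one_mul]
  linarith [abs_nonneg (F.eigenfun (-1) k x)]

/-- Reflection in side j reverses the normal component of a wave vector, so with equal signs the
paired terms of the normal derivative contain a difference of sines, again bounded by a multiple of
`F.side j x`. -/
theorem abs_normalDeriv_eigenfun_le (k : ℤ × ℤ) (j : Fin 3) {x : Plane} (hx : 0 ≤ F.side j x) :
    |∑ i, partialDeriv i (F.eigenfun 1 k) x * partialDeriv i (F.side j) x| ≤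
      (∑ g, |inner ℝ (F.wave (hexAct g k)) (F.normal j)| *
        (2 * Real.pi * |(sideCoeff j (hexAct g k) : ℝ)|)) * F.side j x := by
  have e : ∑ i, partialDeriv i (F.eigenfun 1 k) x * partialDeriv i (F.side j) x =
      ∑ g, -(hexSign 1 g * inner ℝ (F.wave (hexAct g k)) (F.normal j)) *
        Real.sin (inner ℝ (F.wave (hexAct g k)) (x - F.origin)) := by
    simp only [partialDeriv_eigenfun, partialDeriv_side, Finset.sum_mul]
    rw [Finset.sum_comm]
    refine Finset.sum_congr rfl fun g _ ↦ ?_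
    rw [real_inner_eq_sum (F.wave _) (F.normal j)]
    simp only [Fin.sum_univ_two]
    ring
  have h2 : 2 * |∑ i, partialDeriv i (F.eigenfun 1 k) x * partialDeriv i (F.side j) x| ≤
      (∑ g, |inner ℝ (F.wave (hexAct g k)) (F.normal j)| *
        (2 * Real.pi * |(sideCoeff j (hexAct g k) : ℝ)|)) * F.side j x := by
    rw [e, ← abs_two, ← abs_mul, abs_two, two_mul_sum_eq j, Finset.sum_mul]
    refine (Finset.abs_sum_le_sum_abs _ _).trans (Finset.sum_le_sum fun g _ ↦ ?_)
    rw [mul_assoc]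
    refine le_trans (le_of_eq ?_) (mul_le_mul_of_nonneg_left
      (F.abs_sin_sub_sin_hexRefl_le j (hexAct g k) hx) (abs_nonneg _))
    have hneg : inner ℝ (F.wave (hexRefl j (hexAct g k))) (F.normal j) =
        -inner ℝ (F.wave (hexAct g k)) (F.normal j) := by
      rw [inner_wave_normal, inner_wave_normal, sideCoeff_hexRefl]
      push_cast
      ring
    have hone (g : Fin 12) : hexSign 1 g = 1 := by simp [hexSign]
    rw [hone, hone, hexAct_hexReflMul, hneg, ← abs_mul, ← abs_neg]
    congr 1
    ring
  linarith [abs_nonneg (∑ i, partialDeriv i (F.eigenfun 1 k) x * partialDeriv i (F.side j) x)]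

variable {Ω : Opens Plane}

/-- The function `eigenfun` as an element of `L²(Ω)`. -/
noncomputable def eigenvec (hΩ : Bornology.IsBounded (Ω : Set Plane)) (s : ℝ) (k : ℤ × ℤ) : L2 Ω :=
  contToL2 hΩ (F.eigenfun_contDiff s k).continuous

theorem eigenvec_mem_dirichletEigenspace (hΩ : Bornology.IsBounded (Ω : Set Plane))
    (hside : ∀ x, x ∈ Ω ↔ ∀ j, 0 < F.side j x) (k : ℤ × ℤ) :
    F.eigenvec hΩ (-1) k ∈ dirichletEigenspace Ω (F.freq k) := by
  refine ⟨_, _, solvesHelmholtz_contToL2 hΩ (F.eigenfun_contDiff (-1) k)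
    (F.laplacian_eigenfun (-1) k), dirichletCondition_contToL2 hΩ F.side_contDiff hside
    (F.eigenfun_contDiff (-1) k) (C := ∑ j, ∑ i, (∑ g, 2 * Real.pi *
      |(sideCoeff j (hexAct g k) : ℝ)|) * |F.normal j i|) fun x hx i j ↦ ?_⟩
  have hxj := ((hside x).1 hx j).le
  rw [partialDeriv_side, abs_mul]
  have h1 := mul_le_mul_of_nonneg_right (F.abs_eigenfun_le k j hxj) (abs_nonneg (F.normal j i))
  refine h1.trans ?_
  rw [mul_right_comm]
  refine mul_le_mul_of_nonneg_right ?_ hxj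
  refine le_trans ?_ (Finset.single_le_sum (f := fun j ↦ ∑ i, (∑ g, 2 * Real.pi *
    |(sideCoeff j (hexAct g k) : ℝ)|) * |F.normal j i|) (fun j _ ↦ by positivity)
    (Finset.mem_univ j))
  exact Finset.single_le_sum (f := fun i ↦ (∑ g, 2 * Real.pi *
    |(sideCoeff j (hexAct g k) : ℝ)|) * |F.normal j i|) (fun j _ ↦ by positivity)
    (Finset.mem_univ i)

theorem eigenvec_mem_neumannEigenspace (hΩ : Bornology.IsBounded (Ω : Set Plane))
    (hside : ∀ x, x ∈ Ω ↔ ∀ j, 0 < F.side j x) (k : ℤ × ℤ) :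
    F.eigenvec hΩ 1 k ∈ neumannEigenspace Ω (F.freq k) := by
  refine ⟨_, _, solvesHelmholtz_contToL2 hΩ (F.eigenfun_contDiff 1 k)
    (F.laplacian_eigenfun 1 k), neumannCondition_contToL2 hΩ F.side_contDiff hside
    (F.eigenfun_contDiff 1 k) (C := ∑ j, ∑ g, |inner ℝ (F.wave (hexAct g k)) (F.normal j)| *
        (2 * Real.pi * |(sideCoeff j (hexAct g k) : ℝ)|)) fun x hx j ↦ ?_⟩
  have hxj := ((hside x).1 hx j).le
  refine (F.abs_normalDeriv_eigenfun_le k j hxj).trans (mul_le_mul_of_nonneg_right ?_ hxj)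
  exact Finset.single_le_sum (f := fun j ↦ ∑ g, |inner ℝ (F.wave (hexAct g k)) (F.normal j)| *
    (2 * Real.pi * |(sideCoeff j (hexAct g k) : ℝ)|)) (fun j _ ↦ by positivity) (Finset.mem_univ j)

end HexFrame

/-! ### Completeness -/

/-- Trigonometric polynomials are uniformly dense in the continuous functions, and integration
against a finite measure is uniformly continuous. -/
theorem UnitAddTorus.ext_of_integral_mFourier_eq {d : Type*} [Fintype d]
    {μ ν : Measure (UnitAddTorus d)} [IsFiniteMeasure μ] [IsFiniteMeasure ν]
    (h : ∀ n : d → ℤ, ∫ x, UnitAddTorus.mFourier n x ∂μ = ∫ x, UnitAddTorus.mFourier n x ∂ν) :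
    μ = ν := by
  have hint : ∀ (ρ : Measure (UnitAddTorus d)) [IsFiniteMeasure ρ] (f : C(UnitAddTorus d, ℂ)),
      Integrable f ρ := fun ρ _ f ↦
    Integrable.of_bound f.continuous.aestronglyMeasurable ‖f‖ (ae_of_all _ f.norm_coe_le_norm)
  have hcont : ∀ (ρ : Measure (UnitAddTorus d)) [IsFiniteMeasure ρ],
      Continuous fun f : C(UnitAddTorus d, ℂ) ↦ ∫ x, f x ∂ρ := fun ρ _ ↦ by
    refine (LipschitzWith.of_dist_le_mul (K := (ρ Set.univ).toNNReal) fun f g ↦ ?_).continuous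
    rw [dist_eq_norm, dist_eq_norm, ← integral_sub (hint ρ f) (hint ρ g), mul_comm]
    refine norm_integral_le_of_norm_le_const (ae_of_all _ fun x ↦ ?_)
    exact (f - g).norm_coe_le_norm x
  let V : Submodule ℂ C(UnitAddTorus d, ℂ) :=
    { carrier := {f | ∫ x, f x ∂μ = ∫ x, f x ∂ν}
      zero_mem' := by simp
      add_mem' := fun {f g} hf hg ↦ by
        simp only [Set.mem_ofPred_eq, ContinuousMap.add_apply] at *
        rw [integral_add (hint μ f) (hint μ g), integral_add (hint ν f) (hint ν g), hf, hg]
      smul_mem' := fun c f hf ↦ by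
        simp only [Set.mem_ofPred_eq, ContinuousMap.smul_apply] at *
        rw [integral_smul, integral_smul, hf] }
  have hV : V = ⊤ := by
    rw [eq_top_iff, ← UnitAddTorus.span_mFourier_closure_eq_top]
    refine Submodule.topologicalClosure_minimal _ (Submodule.span_le.2 ?_) ?_
    · rintro _ ⟨n, rfl⟩
      exact h n
    · exact isClosed_eq (hcont μ) (hcont ν)
  refine ext_of_forall_integral_eq_of_IsFiniteMeasure fun f ↦ ?_
  have hf : (⟨fun x ↦ (f x : ℂ), by fun_prop⟩ : C(UnitAddTorus d, ℂ)) ∈ V := by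
    rw [hV]
    trivial
  have hf' : ∫ x, (f x : ℂ) ∂μ = ∫ x, (f x : ℂ) ∂ν := hf
  rw [integral_complex_ofReal, integral_complex_ofReal] at hf'
  exact_mod_cast hf'

/-- The transpose of `hexAct`, acting on coordinates. -/
def hexDual (g : Fin 12) (a b : ℝ) : ℝ × ℝ :=
  ![(a, b), (a + b, -a), (b, -a - b), (-a, -b), (-a - b, a), (-b, a + b), (b, a), (a + b, -b),
    (a, -a - b), (-b, -a), (-a - b, b), (-a, a + b)] g

theorem hexDual_pairing (g : Fin 12) (a b : ℝ) (k : ℤ × ℤ) :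
    k.1 * (hexDual g a b).1 + k.2 * (hexDual g a b).2 =
      (hexAct g k).1 * a + (hexAct g k).2 * b := by
  fin_cases g <;> simp [hexDual, hexAct] <;> ring

/-- The triangle is a strict fundamental domain for the group generated by integer translations
and the dihedral group. -/
theorem hexDual_fundamental {g : Fin 12} {a b a' b' : ℝ} {i j : ℤ} (h1 : 0 < b) (h2 : b < a)
    (h3 : 2 * a + b < 1) (h1' : 0 < b') (h2' : b' < a') (h3' : 2 * a' + b' < 1)
    (hi : (hexDual g a b).1 - a' = i) (hj : (hexDual g a b).2 - b' = j) :
    g = 0 ∧ a = a' ∧ b = b' := by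
  fin_cases g <;> simp only [hexDual, Fin.reduceFinMk, Matrix.cons_val, Fin.zero_eta,
    Fin.mk_one, Fin.isValue, Matrix.cons_val_zero, Matrix.cons_val_one] at hi hj <;>
  have l1 : (-2 : ℝ) < i := by linarith
  all_goals
    -- All coordinates of the triangle and of its dihedral images lie strictly between -1 and 1, so
    -- i and j are -1, 0 or 1 and each case is a system of linear inequalities.
    have l2 : (i : ℝ) < 2 := by linarith
    have l3 : (-2 : ℝ) < j := by linarith
    have l4 : (j : ℝ) < 2 := by linarith
    have l1 : -2 < i := by exact_mod_cast l1
    have l2 : i < 2 := by exact_mod_cast l2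
    have l3 : -2 < j := by exact_mod_cast l3
    have l4 : j < 2 := by exact_mod_cast l4
    interval_cases i <;> interval_cases j <;> push_cast at hi hj <;>
    first
      | (exfalso; linarith)
      | exact ⟨rfl, by linarith, by linarith⟩

/-! ### Folding the triangle onto the torus. -/

namespace HexFrame

variable (F : HexFrame)

theorem eq_of_coord_eq {x y : Plane} (h1 : F.fstCoord x = F.fstCoord y)
    (h2 : F.sndCoord x = F.sndCoord y) : x = y := by
  have hs := F.size_pos.ne'
  have e1 : inner ℝ F.va (x - y) = 0 := by
    have := sub_eq_zero.2 h1
    rwa [fstCoord, fstCoord, ← inner_sub_right, sub_sub_sub_cancel_right] at this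
  have e2 : inner ℝ F.vb (x - y) = 0 := by
    have := sub_eq_zero.2 h2
    rwa [sndCoord, sndCoord, ← inner_sub_right, sub_sub_sub_cancel_right] at this
  have g1 := F.inner_va_va
  have g2 := F.inner_vb_vb
  have g3 := F.inner_va_vb
  rw [real_inner_eq_sum, Fin.sum_univ_two] at e1 e2 g1 g2 g3
  set a := F.va 0
  set b := F.va 1
  set c := F.vb 0
  set d := F.vb 1
  -- The Gram determinant of `va` and `vb`; it is nonzero, so the coordinates separate points.
  have hdet : (a * d - b * c) ^ 2 = 12 / (81 * F.size ^ 4) := by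
    have : (a * d - b * c) ^ 2 =
        (a * a + b * b) * (c * c + d * d) - (a * c + b * d) ^ 2 := by ring
    rw [this, g1, g2, g3]
    field_simp
    norm_num
  have hdet0 : a * d - b * c ≠ 0 := by
    intro h0
    rw [h0] at hdet
    have : 0 < 12 / (81 * F.size ^ 4) := by have := F.size_pos; positivity
    norm_num at hdet
    linarith
  rw [← sub_eq_zero]
  ext i
  have q0 : (a * d - b * c) * (x - y) 0 = 0 := by linear_combination d * e1 - b * e2
  have q1 : (a * d - b * c) * (x - y) 1 = 0 := by linear_combination a * e2 - c * e1
  fin_cases i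
  · exact (mul_eq_zero.1 q0).resolve_left hdet0
  · exact (mul_eq_zero.1 q1).resolve_left hdet0

/-- The map to the torus given by the coordinates, composed with an element of the dihedral
group. -/
noncomputable def toTorus (g : Fin 12) (x : Plane) : UnitAddTorus (Fin 2) :=
  ![((hexDual g (F.fstCoord x) (F.sndCoord x)).1 : UnitAddCircle),
    ((hexDual g (F.fstCoord x) (F.sndCoord x)).2 : UnitAddCircle)]

theorem continuous_fstCoord : Continuous F.fstCoord :=
  (F.contDiff_inner_sub F.va).continuous

theorem continuous_sndCoord : Continuous F.sndCoord :=
  (F.contDiff_inner_sub F.vb).continuous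

theorem continuous_toTorus (g : Fin 12) : Continuous (F.toTorus g) := by
  have ha := F.continuous_fstCoord
  have hb := F.continuous_sndCoord
  have hd : Continuous fun x ↦ hexDual g (F.fstCoord x) (F.sndCoord x) := by
    fin_cases g <;> simp only [hexDual, Fin.reduceFinMk, Matrix.cons_val, Fin.zero_eta,
      Fin.mk_one, Fin.isValue, Matrix.cons_val_zero, Matrix.cons_val_one] <;> fun_prop
  refine continuous_pi fun i ↦ ?_
  fin_cases i
  · exact (AddCircle.continuous_mk' 1).comp hd.fst
  · exact (AddCircle.continuous_mk' 1).comp hd.snd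

/-- The dihedral element moves from the point to the frequency by transposition. -/
theorem mFourier_toTorus (g : Fin 12) (n : Fin 2 → ℤ) (x : Plane) :
    UnitAddTorus.mFourier n (F.toTorus g x) =
      Complex.exp ((inner ℝ (F.wave (hexAct g (n 0, n 1))) (x - F.origin) : ℝ) * Complex.I) := by
  rw [inner_wave_sub, ← hexDual_pairing]
  simp only [UnitAddTorus.mFourier, ContinuousMap.coe_mk, Fin.prod_univ_two, toTorus,
    Matrix.cons_val_zero, Matrix.cons_val_one]
  rw [fourier_coe_apply, fourier_coe_apply, ← Complex.exp_add]
  congr 1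
  push_cast
  ring

theorem toTorus_eq {Ω : Opens Plane} (hside : ∀ x, x ∈ Ω ↔ ∀ j, 0 < F.side j x) {g : Fin 12}
    {x y : Plane} (hx : x ∈ Ω) (hy : y ∈ Ω) (h : F.toTorus g x = F.toTorus 0 y) :
    g = 0 ∧ x = y := by
  rw [hside] at hx hy
  simp only [side_eq] at hx hy
  have x0 := hx 0
  have x1 := hx 1
  have x2 := hx 2
  have y0 := hy 0
  have y1 := hy 1
  have y2 := hy 2
  simp only [Matrix.cons_val] at x0 x1 x2 y0 y1 y2
  have e1 := congrFun h 0
  have e2 := congrFun h 1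
  simp only [toTorus, Matrix.cons_val_zero, Matrix.cons_val_one] at e1 e2
  rw [← sub_eq_zero, ← AddCircle.coe_sub, AddCircle.coe_eq_zero_iff] at e1 e2
  obtain ⟨i, hi⟩ := e1
  obtain ⟨j, hj⟩ := e2
  obtain ⟨hg, ha, hb⟩ := hexDual_fundamental (g := g) (i := i) (j := j) x0 (sub_pos.1 x1)
    (by linarith) y0 (sub_pos.1 y1) (by linarith) (by simpa [hexDual] using hi.symm)
    (by simpa [hexDual] using hj.symm)
  exact ⟨hg, F.eq_of_coord_eq ha hb⟩

end HexFrame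

/-- The measure on `Ω` whose density is the positive part of `r u`. -/
noncomputable def posPartMeasure {Ω : Opens Plane} (u : L2 Ω) (r : ℝ) : Measure Plane :=
  (volume.restrict (Ω : Set Plane)).withDensity fun x ↦ ENNReal.ofReal (r * u x)

theorem integrable_of_isBounded {Ω : Opens Plane} (hΩ : Bornology.IsBounded (Ω : Set Plane))
    (u : L2 Ω) : Integrable u (volume.restrict (Ω : Set Plane)) :=
  have := isFiniteMeasure_restrict_of_isBounded hΩ
  (Lp.memLp u).integrable (by norm_num)

theorem isFiniteMeasure_posPartMeasure {Ω : Opens Plane}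
    (hΩ : Bornology.IsBounded (Ω : Set Plane)) (u : L2 Ω) (r : ℝ) :
    IsFiniteMeasure (posPartMeasure u r) :=
  isFiniteMeasure_withDensity_ofReal ((integrable_of_isBounded hΩ u).const_mul r).2

theorem posPartMeasure_compl {Ω : Opens Plane} (u : L2 Ω) (r : ℝ) :
    posPartMeasure u r (Ω : Set Plane)ᶜ = 0 := by
  refine withDensity_absolutelyContinuous _ _ ?_
  rw [Measure.restrict_apply Ω.isOpen.measurableSet.compl, Set.compl_inter_self, measure_empty]

/-- The signed measure r u dx is handled as a difference of two finite positive measures. -/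
theorem integral_posPartMeasure_sub {Ω : Opens Plane} (hΩ : Bornology.IsBounded (Ω : Set Plane))
    (u : L2 Ω) (r : ℝ) {f : Plane → ℂ} (hf : Continuous f) {M : ℝ} (hM : ∀ x, ‖f x‖ ≤ M) :
    ∫ x, f x ∂(posPartMeasure u r) - ∫ x, f x ∂(posPartMeasure u (-r)) =
      r * ∫ x in (Ω : Set Plane), u x * f x := by
  have hu := integrable_of_isBounded hΩ u
  have hm (r : ℝ) : AEMeasurable (fun x ↦ ENNReal.ofReal (r * u x))
      (volume.restrict (Ω : Set Plane)) :=
    (hu.aestronglyMeasurable.aemeasurable.const_mul r).ennreal_ofReal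
  have hi (r : ℝ) : Integrable (fun x ↦ (ENNReal.ofReal (r * u x)).toReal • f x)
      (volume.restrict (Ω : Set Plane)) := by
    have h1 : Integrable (fun x ↦ (ENNReal.ofReal (r * u x)).toReal)
        (volume.restrict (Ω : Set Plane)) := by
      simp only [ENNReal.toReal_ofReal']
      exact (hu.const_mul r).pos_part
    exact h1.smul_bdd M hf.aestronglyMeasurable (ae_of_all _ hM)
  rw [posPartMeasure, posPartMeasure,
    integral_withDensity_eq_integral_toReal_smul₀ (hm r) (ae_of_all _ fun _ ↦ ENNReal.ofReal_lt_top),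
    integral_withDensity_eq_integral_toReal_smul₀ (hm (-r))
      (ae_of_all _ fun _ ↦ ENNReal.ofReal_lt_top), ← integral_sub (hi r) (hi (-r)),
    ← integral_const_mul]
  refine integral_congr_ae (ae_of_all _ fun x ↦ ?_)
  simp only [ENNReal.toReal_ofReal', ← sub_smul]
  have : max (r * u x) 0 - max (-r * u x) 0 = r * u x := by
    rw [neg_mul]
    exact max_zero_sub_eq_self _
  rw [this, Complex.real_smul]
  push_cast
  ring

/-- The index of `-hexAct g`. -/
def hexNeg : Fin 12 → Fin 12 := ![3, 4, 5, 0, 1, 2, 9, 10, 11, 6, 7, 8]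

theorem hexNeg_involutive : Function.Involutive hexNeg := by
  intro g
  revert g
  decide

theorem hexAct_hexNeg (g : Fin 12) (k : ℤ × ℤ) : hexAct (hexNeg g) k = -hexAct g k := by
  fin_cases g <;> simp [hexNeg, hexAct, Prod.ext_iff]

theorem hexSign_hexNeg (s : ℝ) (g : Fin 12) : hexSign s (hexNeg g) = hexSign s g := by
  have h : (hexNeg g < 6) ↔ (g < 6) := by
    revert g
    decide
  simp only [hexSign, h]

namespace HexFrame

variable (F : HexFrame)

theorem wave_neg (k : ℤ × ℤ) : F.wave (-k) = -F.wave k := by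
  simp only [wave, Prod.fst_neg, Prod.snd_neg, Int.cast_neg]
  module

/-- The map -1 is a rotation of the dihedral group, so it has sign 1 and pairs opposite sines. Hence
the symmetrized exponential is the real function `eigenfun`. -/
theorem sum_hexSign_sin (s : ℝ) (k : ℤ × ℤ) (x : Plane) :
    ∑ g, hexSign s g * Real.sin (inner ℝ (F.wave (hexAct g k)) (x - F.origin)) = 0 := by
  have h := Equiv.sum_comp hexNeg_involutive.toPerm
    fun g ↦ hexSign s g * Real.sin (inner ℝ (F.wave (hexAct g k)) (x - F.origin))
  simp only [Function.Involutive.coe_toPerm, hexSign_hexNeg, hexAct_hexNeg, wave_neg,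
    inner_neg_left, Real.sin_neg, mul_neg, Finset.sum_neg_distrib] at h
  linarith

theorem sum_hexSign_exp (s : ℝ) (k : ℤ × ℤ) (x : Plane) :
    ∑ g, (hexSign s g : ℂ) *
      Complex.exp ((inner ℝ (F.wave (hexAct g k)) (x - F.origin) : ℝ) * Complex.I) =
      F.eigenfun s k x := by
  have h := congrArg (Complex.ofReal) (F.sum_hexSign_sin s k x)
  simp only [Complex.exp_mul_I, mul_add, Finset.sum_add_distrib, eigenfun]
  push_cast at h ⊢
  simp only [← mul_assoc]
  rw [← Finset.sum_mul, h, zero_mul, add_zero]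

variable {Ω : Opens Plane}

/-- The difference of the two sides is the sum of the signed copies of u dx on the torus. Its
Fourier coefficient at n is the integral of u times `eigenfun` at n, which vanishes. -/
theorem sum_map_posPartMeasure_eq (hΩ : Bornology.IsBounded (Ω : Set Plane)) (s : ℝ) {u : L2 Ω}
    (hu : ∀ k, inner ℝ u (F.eigenvec hΩ s k) = 0) :
    ∑ g, (posPartMeasure u (hexSign s g)).map (F.toTorus g) =
      ∑ g, (posPartMeasure u (-hexSign s g)).map (F.toTorus g) := by
  have hfin := isFiniteMeasure_posPartMeasure hΩ u
  have hc := F.continuous_toTorus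
  refine UnitAddTorus.ext_of_integral_mFourier_eq fun n ↦ ?_
  have hint (ρ : Measure (UnitAddTorus (Fin 2))) [IsFiniteMeasure ρ] :
      Integrable (UnitAddTorus.mFourier n) ρ :=
    Integrable.of_bound (UnitAddTorus.mFourier n).continuous.aestronglyMeasurable _
      (ae_of_all _ (UnitAddTorus.mFourier n).norm_coe_le_norm)
  rw [integral_finsetSum_measure fun g _ ↦ hint _, integral_finsetSum_measure fun g _ ↦ hint _,
    ← sub_eq_zero, ← Finset.sum_sub_distrib]
  have e (g : Fin 12) : ∫ y, UnitAddTorus.mFourier n y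
        ∂((posPartMeasure u (hexSign s g)).map (F.toTorus g)) -
      ∫ y, UnitAddTorus.mFourier n y ∂((posPartMeasure u (-hexSign s g)).map (F.toTorus g)) =
      ∫ x in (Ω : Set Plane), u x * ((hexSign s g : ℂ) * Complex.exp
        ((inner ℝ (F.wave (hexAct g (n 0, n 1))) (x - F.origin) : ℝ) * Complex.I)) := by
    rw [integral_map (hc g).measurable.aemeasurable
      (UnitAddTorus.mFourier n).continuous.aestronglyMeasurable,
      integral_map (hc g).measurable.aemeasurable
      (UnitAddTorus.mFourier n).continuous.aestronglyMeasurable,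
      integral_posPartMeasure_sub (f := fun x ↦ UnitAddTorus.mFourier n (F.toTorus g x)) hΩ u _
        ((UnitAddTorus.mFourier n).continuous.comp (hc g))
        fun x ↦ (UnitAddTorus.mFourier n).norm_coe_le_norm _, ← integral_const_mul]
    refine integral_congr_ae (ae_of_all _ fun x ↦ ?_)
    simp only [mFourier_toTorus]
    ring
  simp_rw [e]
  rw [← integral_finsetSum]
  · simp_rw [← Finset.mul_sum, sum_hexSign_exp]
    have h := hu (n 0, n 1)
    rw [eigenvec, contToL2, inner_toLp] at h
    have h' := congrArg Complex.ofReal h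
    rw [← integral_complex_ofReal] at h'
    push_cast at h'
    exact h'
  · intro g _
    refine (integrable_of_isBounded hΩ u).ofReal.mul_bdd (c := |hexSign s g|) ?_ (ae_of_all _ fun x ↦ ?_)
    · have := (F.contDiff_inner_sub (F.wave (hexAct g (n 0, n 1)))).continuous
      exact Continuous.aestronglyMeasurable (by fun_prop)
    · rw [norm_mul, Complex.norm_exp_ofReal_mul_I, mul_one, Complex.norm_real, Real.norm_eq_abs]

/-- By `toTorus_eq` the image of Ω under `toTorus 0` is an injective copy disjoint from the other
eleven, so only the term g = 0 charges it. -/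
theorem posPartMeasure_image (hside : ∀ x, x ∈ Ω ↔ ∀ j, 0 < F.side j x) (u : L2 Ω)
    (r : Fin 12 → ℝ) {S : Set Plane} (hS : MeasurableSet S) (hSΩ : S ⊆ Ω) :
    (∑ g, (posPartMeasure u (r g)).map (F.toTorus g)) (F.toTorus 0 '' S) =
      posPartMeasure u (r 0) S := by
  have hc := F.continuous_toTorus
  have hT : MeasurableSet (F.toTorus 0 '' S) :=
    hS.image_of_continuousOn_injOn (hc 0).continuousOn fun x hx y hy h ↦
      (F.toTorus_eq hside (hSΩ hx) (hSΩ hy) h).2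
  rw [Measure.finsetSum_apply, Finset.sum_eq_single 0]
  · rw [Measure.map_apply (hc 0).measurable hT]
    refine measure_congr ?_
    have hae : ∀ᵐ x ∂(posPartMeasure u (r 0)), x ∈ (Ω : Set Plane) := posPartMeasure_compl u _
    filter_upwards [hae] with x hx
    refine propext ⟨?_, fun hxS ↦ ⟨x, hxS, rfl⟩⟩
    rintro ⟨y, hy, hxy⟩
    rw [← (F.toTorus_eq hside (hSΩ hy) hx hxy).2]
    exact hy
  · intro g _ hg
    rw [Measure.map_apply (hc g).measurable hT]
    refine measure_mono_null (t := (Ω : Set Plane)ᶜ) (fun x hx hxΩ ↦ ?_) (posPartMeasure_compl u (r g))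
    obtain ⟨y, hy, hxy⟩ := hx
    exact hg (F.toTorus_eq hside hxΩ (hSΩ hy) hxy.symm).1
  · simp

/-- The functions `eigenfun` are complete in `L²(Ω)`. -/
theorem eq_zero_of_inner_eigenvec (hΩ : Bornology.IsBounded (Ω : Set Plane))
    (hside : ∀ x, x ∈ Ω ↔ ∀ j, 0 < F.side j x) (s : ℝ) {u : L2 Ω}
    (hu : ∀ k, inner ℝ u (F.eigenvec hΩ s k) = 0) : u = 0 := by
  have hint := integrable_of_isBounded hΩ u
  have h := F.sum_map_posPartMeasure_eq hΩ s hu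
  have hS {S : Set Plane} (hS : MeasurableSet S) (hSΩ : S ⊆ Ω) :
      posPartMeasure u 1 S = posPartMeasure u (-1) S := by
    have e1 := F.posPartMeasure_image hside u (hexSign s) hS hSΩ
    have e2 := F.posPartMeasure_image hside u (fun g ↦ -hexSign s g) hS hSΩ
    rw [h, e2] at e1
    exact e1.symm
  have heq : posPartMeasure u 1 = posPartMeasure u (-1) := by
    ext S hSm
    rw [← measure_inter_add_sdiff S Ω.isOpen.measurableSet,
      ← measure_inter_add_sdiff (μ := posPartMeasure u (-1)) S Ω.isOpen.measurableSet,
      hS (hSm.inter Ω.isOpen.measurableSet) Set.inter_subset_right,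
      measure_mono_null (Set.sdiff_subset_compl S Ω) (posPartMeasure_compl u 1),
      measure_mono_null (Set.sdiff_subset_compl S Ω) (posPartMeasure_compl u (-1))]
  have hm (r : ℝ) : AEMeasurable (fun x ↦ ENNReal.ofReal (r * u x))
      (volume.restrict (Ω : Set Plane)) :=
    (hint.aestronglyMeasurable.aemeasurable.const_mul r).ennreal_ofReal
  have hae := (withDensity_eq_iff (hm 1) (hm (-1)) ((isFiniteMeasure_posPartMeasure hΩ u 1
    |> fun hf ↦ by
      have := hf.measure_univ_lt_top
      rw [posPartMeasure, withDensity_apply _ MeasurableSet.univ, Measure.restrict_univ] at this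
      exact this.ne))).1 heq
  rw [Lp.eq_zero_iff_ae_eq_zero]
  filter_upwards [hae] with x hx
  change u x = 0
  rcases le_total 0 (u x) with h0 | h0
  · rw [one_mul, ENNReal.ofReal_of_nonpos (p := -1 * u x) (by linarith)] at hx
    exact le_antisymm (ENNReal.ofReal_eq_zero.1 hx) h0
  · rw [one_mul, ENNReal.ofReal_of_nonpos h0] at hx
    have := ENNReal.ofReal_eq_zero.1 hx.symm
    exact le_antisymm h0 (by linarith)

end HexFrame

/-! ### Eigenspaces of a complete family of eigenvectors -/

section spectral

variable {H ι : Type*} [NormedAddCommGroup H] [InnerProductSpace ℝ H] {V : ℝ → Submodule ℝ H}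
  {e : ι → H} {ev : ι → ℝ}

/-- The component of an eigenvector orthogonal to the span is again in `V lam`. It is orthogonal to
the `e i` with this eigenvalue by construction and to the others by `horth`, so completeness makes
it zero. -/
theorem eigenspace_eq_span (he : ∀ i, e i ∈ V (ev i))
    (horth : ∀ lam mu, lam ≠ mu → ∀ u ∈ V lam, ∀ v ∈ V mu, inner ℝ u v = 0)
    (hcomp : ∀ u, (∀ i, inner ℝ u (e i) = 0) → u = 0) (hfin : ∀ lam, {i | ev i = lam}.Finite)
    (lam : ℝ) : V lam = Submodule.span ℝ (e '' {i | ev i = lam}) := by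
  set W := Submodule.span ℝ (e '' {i | ev i = lam}) with hW
  have : FiniteDimensional ℝ W := FiniteDimensional.span_of_finite ℝ ((hfin lam).image e)
  have hWV : W ≤ V lam := Submodule.span_le.2 (by
    rintro _ ⟨i, rfl, rfl⟩
    exact he i)
  refine le_antisymm (fun u hu ↦ ?_) hWV
  obtain ⟨y, hy, z, hz, rfl⟩ := W.exists_add_mem_mem_orthogonal u
  have hzV : z ∈ V lam := by simpa using (V lam).sub_mem hu (hWV hy)
  have hz0 : z = 0 := hcomp z fun i ↦ by
    by_cases hi : ev i = lam
    · exact (Submodule.mem_orthogonal' W z).1 hz _ (Submodule.subset_span ⟨i, hi, rfl⟩)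
    · exact horth _ _ (Ne.symm hi) z hzV _ (he i)
  rw [hz0, add_zero]
  exact hy

theorem finrank_span_fiber (hli : LinearIndependent ℝ e) (hfin : ∀ lam, {i | ev i = lam}.Finite)
    (lam : ℝ) : Module.finrank ℝ (Submodule.span ℝ (e '' {i | ev i = lam})) =
      Nat.card {i // ev i = lam} := by
  have : Fintype {i // ev i = lam} := (hfin lam).fintype
  have h : e '' {i | ev i = lam} = Set.range (e ∘ (Subtype.val : {i // ev i = lam} → ι)) := by
    ext
    simp
  rw [h, finrank_span_eq_card (hli.comp _ Subtype.val_injective), Nat.card_eq_fintype_card]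

theorem hasSum_card_fiber_mul_exp (hfin : ∀ lam, {i | ev i = lam}.Finite) {t T : ℝ}
    (hT : HasSum (fun i ↦ Real.exp (-ev i * t)) T) :
    HasSum (fun lam ↦ (Nat.card {i // ev i = lam} : ℝ) * Real.exp (-lam * t)) T := by
  rw [← (Equiv.sigmaFiberEquiv ev).hasSum_iff] at hT
  refine hT.sigma fun lam ↦ ?_
  have : Fintype {i // ev i = lam} := (hfin lam).fintype
  convert hasSum_fintype _ using 1
  rw [Finset.sum_congr rfl fun i _ ↦ (by
    simp [Equiv.sigmaFiberEquiv, i.2] : _ = Real.exp (-lam * t)), Finset.sum_const,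
    Finset.card_univ, nsmul_eq_mul, Nat.card_eq_fintype_card]

end spectral

/-! ### The chamber is a set of representatives -/

theorem eq_of_hexAct_eq {k k' : ℤ × ℤ} {g : Fin 12} (h1 : k.2 ≤ k.1) (h2 : k.1 ≤ 2 * k.2)
    (h1' : k'.2 ≤ k'.1) (h2' : k'.1 ≤ 2 * k'.2) (h : hexAct g k = k') : k = k' := by
  subst h
  ext <;> fin_cases g <;> simp [hexAct] at * <;> omega

theorem eq_zero_of_hexAct_eq {k : ℤ × ℤ} {g : Fin 12} (h1 : k.2 < k.1) (h2 : k.1 < 2 * k.2)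
    (h : hexAct g k = k) : g = 0 := by
  fin_cases g <;> simp [hexAct, Prod.ext_iff] at h ⊢ <;> omega

/-- The count in `card_hexAct_chamber_closed` is at least 1. -/
theorem exists_hexAct_mem_closed (k : ℤ × ℤ) : ∃ g, hexAct g k ∈ Set.range (chamberPoint 0) := by
  by_contra! h
  simp only [mem_range_chamberPoint] at h
  have hc := card_hexAct_chamber_closed k
  rw [Finset.sum_eq_zero fun g _ ↦ if_neg (h g)] at hc
  split_ifs at hc <;> omega

/-- A point fixed by no reflection is off all six lines, where the orbit count is nonzero. The
second alternative is the case of a vanishing Dirichlet wave. -/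
theorem exists_hexAct_mem_open (k : ℤ × ℤ) : (∃ g, hexAct g k ∈ Set.range (chamberPoint 1)) ∨
    ∃ g, hexSign (-1) g = -1 ∧ hexAct g k = k := by
  by_contra! h
  obtain ⟨h, h'⟩ := h
  simp only [mem_range_chamberPoint] at h
  have hc := card_hexAct_chamber_open k
  rw [Finset.sum_eq_zero fun g _ ↦ if_neg (h g)] at hc
  have l1 : k.1 ≠ k.2 := fun e ↦ h' 6 (by simp [hexSign]) (Prod.ext e.symm e)
  have l2 : k.2 ≠ 0 := fun e ↦ h' 8 (by simp [hexSign]) (by ext <;> simp [hexAct, e])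
  have l3 : k.1 ≠ 0 := fun e ↦ h' 10 (by simp [hexSign]) (by ext <;> simp [hexAct, e])
  have l4 : k.1 ≠ 2 * k.2 := fun e ↦ h' 7 (by simp [hexSign]) (by
    ext <;> simp [hexAct]; omega)
  have l5 : k.1 ≠ -k.2 := fun e ↦ h' 9 (by simp [hexSign]) (by ext <;> simp [hexAct, e])
  have l6 : k.2 ≠ 2 * k.1 := fun e ↦ h' 11 (by simp [hexSign]) (by
    ext <;> simp [hexAct]; omega)
  rw [if_neg l1, if_neg l2, if_neg l3, if_neg l4, if_neg l5, if_neg l6] at hc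
  split_ifs at hc <;> omega

/-- Right multiplication by the generating reflections on the index set of `hexAct`. -/
def hexMulRefl (b : Fin 2) : Fin 12 → Fin 12 :=
  ![![6, 11, 10, 9, 8, 7, 0, 5, 4, 3, 2, 1], ![7, 6, 11, 10, 9, 8, 1, 0, 5, 4, 3, 2]] b

theorem hexMulRefl_involutive (b : Fin 2) : Function.Involutive (hexMulRefl b) := by
  intro g
  revert b g
  decide

theorem hexAct_hexMulRefl_zero (g : Fin 12) (k : ℤ × ℤ) :
    hexAct (hexMulRefl 0 g) k = hexAct g (k.2, k.1) := by
  fin_cases g <;> simp [hexMulRefl, hexAct]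

theorem hexAct_hexMulRefl_one (g : Fin 12) (k : ℤ × ℤ) :
    hexAct (hexMulRefl 1 g) k = hexAct g (k.1, k.1 - k.2) := by
  fin_cases g <;> simp [hexMulRefl, hexAct]

theorem hexSign_hexMulRefl {s : ℝ} (hs : s * s = 1) (b : Fin 2) (g : Fin 12) :
    hexSign s (hexMulRefl b g) = s * hexSign s g := by
  have h : (hexMulRefl b g < 6) ↔ ¬ (g < 6) := by
    revert b g
    decide
  rw [hexSign, hexSign]
  by_cases hg : g < 6
  · rw [if_neg (by tauto), if_pos hg, mul_one]
  · rw [if_pos (by tauto), if_neg hg, hs]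

/-! ### Symmetry and linear independence of the eigenfunctions. -/

namespace HexFrame

variable (F : HexFrame)

theorem eigenfun_swap {s : ℝ} (hs : s * s = 1) (m n : ℤ) (x : Plane) :
    F.eigenfun s (n, m) x = s * F.eigenfun s (m, n) x := by
  rw [eigenfun, eigenfun, Finset.mul_sum, ← Equiv.sum_comp (hexMulRefl_involutive 0).toPerm]
  refine Finset.sum_congr rfl fun g _ ↦ ?_
  rw [Function.Involutive.coe_toPerm, hexAct_hexMulRefl_zero, hexSign_hexMulRefl hs, mul_assoc]

theorem eigenfun_sub {s : ℝ} (hs : s * s = 1) (m n : ℤ) (x : Plane) :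
    F.eigenfun s (m, m - n) x = s * F.eigenfun s (m, n) x := by
  rw [eigenfun, eigenfun, Finset.mul_sum, ← Equiv.sum_comp (hexMulRefl_involutive 1).toPerm]
  refine Finset.sum_congr rfl fun g _ ↦ ?_
  rw [Function.Involutive.coe_toPerm, hexAct_hexMulRefl_one, hexSign_hexMulRefl hs, mul_assoc,
    sub_sub_cancel]

end HexFrame

/-- The character `(a, b) ↦ exp (2πi (m a + n b))` of the plane. -/
noncomputable def planeChar (k : ℤ × ℤ) : Multiplicative (ℝ × ℝ) →* ℂ where
  toFun z := Complex.exp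
    ((2 * Real.pi * (k.1 * z.toAdd.1 + k.2 * z.toAdd.2) : ℝ) * Complex.I)
  map_one' := by simp
  map_mul' z w := by
    rw [← Complex.exp_add]
    congr 1
    simp only [toAdd_mul, Prod.fst_add, Prod.snd_add]
    push_cast
    ring

theorem int_eq_of_exp_eq {m n : ℤ} (h : ∀ a : ℝ, Complex.exp ((2 * Real.pi * (m * a) : ℝ) *
    Complex.I) = Complex.exp ((2 * Real.pi * (n * a) : ℝ) * Complex.I)) : m = n := by
  by_contra hne
  have hne' : (m : ℝ) - n ≠ 0 := sub_ne_zero.2 (by exact_mod_cast hne)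
  -- At this point the two phases differ by π, so the exponentials are opposite.
  have h1 := h (1 / (2 * ((m : ℝ) - n)))
  have e : ((2 * Real.pi * (m * (1 / (2 * ((m : ℝ) - n)))) : ℝ) : ℂ) * Complex.I =
      ((2 * Real.pi * (n * (1 / (2 * ((m : ℝ) - n)))) : ℝ) : ℂ) * Complex.I +
        Real.pi * Complex.I := by
    rw [← add_mul, ← Complex.ofReal_add]
    congr 2
    field_simp
    ring
  rw [e, Complex.exp_add, Complex.exp_pi_mul_I] at h1
  have h0 := Complex.exp_ne_zero (((2 * Real.pi * (n * (1 / (2 * ((m : ℝ) - n)))) : ℝ) : ℂ) *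
    Complex.I)
  refine h0 ?_
  linear_combination -(1 / 2 : ℂ) * h1

theorem planeChar_injective : Function.Injective planeChar := fun k l h ↦ by
  have h' (a b : ℝ) := DFunLike.congr_fun h (Multiplicative.ofAdd (a, b))
  simp only [planeChar, MonoidHom.coe_mk, OneHom.coe_mk, toAdd_ofAdd] at h'
  refine Prod.ext (int_eq_of_exp_eq fun a ↦ ?_) (int_eq_of_exp_eq fun a ↦ ?_)
  · simpa using h' a 0
  · simpa using h' 0 a

theorem linearIndependent_planeChar :
    LinearIndependent ℂ fun k : ℤ × ℤ ↦ (planeChar k : Multiplicative (ℝ × ℝ) → ℂ) :=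
  (linearIndependent_monoidHom (Multiplicative (ℝ × ℝ)) ℂ).comp planeChar planeChar_injective

namespace HexFrame

variable (F : HexFrame)

/-- Two reflections generate the dihedral group. Applying them alternately from (m, n), in both
directions, reaches the whole orbit; `e1`, …, `e11` record the sign at each index. -/
theorem eigenfun_hexAct {s : ℝ} (hs : s * s = 1) (g : Fin 12) (k : ℤ × ℤ) (x : Plane) :
    F.eigenfun s (hexAct g k) x = hexSign s g * F.eigenfun s k x := by
  obtain ⟨m, n⟩ := k
  have A := fun m n ↦ F.eigenfun_swap hs m n x
  have B := fun m n ↦ F.eigenfun_sub hs m n x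
  have ss (y : ℝ) : s * (s * y) = y := by rw [← mul_assoc, hs, one_mul]
  have e7 := B m n
  have e1 := A m (m - n)
  rw [e7, ss] at e1
  have e8 := B (m - n) m
  rw [e1, show m - n - m = -n by ring] at e8
  have e2 := A (m - n) (-n)
  rw [e8, ss] at e2
  have e9 := B (-n) (m - n)
  rw [e2, show -n - (m - n) = -m by ring] at e9
  have e3 := A (-n) (-m)
  rw [e9, ss] at e3
  have e6 := A m n
  have e5 := B n m
  rw [e6, ss] at e5
  have e11 := A n (n - m)
  rw [e5] at e11
  have e4 := B (n - m) n
  rw [e11, ss, show n - m - n = -m by ring] at e4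
  have e10 := A (n - m) (-m)
  rw [e4] at e10
  fin_cases g <;> simp [hexAct, hexSign, e1, e2, e3, e4, e5, e6, e7, e8, e9, e10, e11]

theorem exists_coord_eq (a b : ℝ) : ∃ x, F.fstCoord x = a ∧ F.sndCoord x = b := by
  have hs := F.size_pos.ne'
  have hba := (real_inner_comm F.va F.vb).trans F.inner_va_vb
  refine ⟨F.origin + (3 * F.size ^ 2 / 2) • ((2 * a + b) • F.va + (a + 2 * b) • F.vb), ?_, ?_⟩
  · rw [fstCoord, add_sub_cancel_left, real_inner_smul_right, inner_add_right,
      real_inner_smul_right, real_inner_smul_right, F.inner_va_va, F.inner_va_vb]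
    field_simp
    ring
  · rw [sndCoord, add_sub_cancel_left, real_inner_smul_right, inner_add_right,
      real_inner_smul_right, real_inner_smul_right, F.inner_vb_vb, hba]
    field_simp
    ring

theorem sum_hexSign_planeChar (s : ℝ) (k : ℤ × ℤ) (x : Plane) :
    ∑ g, (hexSign s g : ℂ) *
      planeChar (hexAct g k) (Multiplicative.ofAdd (F.fstCoord x, F.sndCoord x)) =
      F.eigenfun s k x := by
  rw [← sum_hexSign_exp]
  refine Finset.sum_congr rfl fun g _ ↦ ?_
  rw [inner_wave_sub]
  rfl

theorem analyticOnNhd_eigenfun (s : ℝ) (k : ℤ × ℤ) :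
    AnalyticOnNhd ℝ (F.eigenfun s k) Set.univ := by
  have h : ContDiff ℝ ⊤ (F.eigenfun s k) :=
    ContDiff.sum fun _ _ ↦ contDiff_const.mul
      ((innerSL ℝ (F.wave _)).contDiff.comp (contDiff_id.sub contDiff_const)).cos
  exact contDiff_omega_iff_analyticOnNhd.1 h

variable {Ω : Opens Plane}

/-- A relation in L²(Ω) holds pointwise on Ω by continuity and on the whole plane by analyticity;
only there does independence of characters apply. -/
theorem eigenfun_sum_eq_zero (hΩ : Bornology.IsBounded (Ω : Set Plane))
    (hne : (Ω : Set Plane).Nonempty) {s : ℝ} {ι : Type*} {S : Finset ι} {c : ι → ℝ}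
    {κ : ι → ℤ × ℤ} (h : ∑ p ∈ S, c p • F.eigenvec hΩ s (κ p) = 0) (x : Plane) :
    ∑ p ∈ S, c p * F.eigenfun s (κ p) x = 0 := by
  have hcont : Continuous fun x ↦ ∑ p ∈ S, c p * F.eigenfun s (κ p) x :=
    continuous_finsetSum _ fun p _ ↦
      continuous_const.mul (F.eigenfun_contDiff s (κ p)).continuous
  have hae : (fun x ↦ ∑ p ∈ S, c p * F.eigenfun s (κ p) x)
      =ᵐ[volume.restrict (Ω : Set Plane)] fun _ ↦ 0 := by
    have h1 : contToL2 hΩ hcont = ∑ p ∈ S, c p • F.eigenvec hΩ s (κ p) := by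
      refine Lp.ext ((coeFn_contToL2 hΩ hcont).trans ?_)
      refine EventuallyEq.trans ?_ (Lp.coeFn_finsetSum S _).symm
      have hall : ∀ᵐ x ∂(volume.restrict (Ω : Set Plane)), ∀ p ∈ S,
          (c p • F.eigenvec hΩ s (κ p) : L2 Ω) x = c p * F.eigenfun s (κ p) x := by
        rw [Finset.eventually_all]
        intro p _
        filter_upwards [Lp.coeFn_smul (c p) (F.eigenvec hΩ s (κ p)),
          coeFn_contToL2 hΩ (F.eigenfun_contDiff s (κ p)).continuous] with x h1 h2
        rw [h1, Pi.smul_apply, eigenvec, h2, smul_eq_mul]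
      filter_upwards [hall] with x hx
      rw [Finset.sum_apply]
      exact (Finset.sum_congr rfl hx).symm
    rw [h] at h1
    refine (coeFn_contToL2 hΩ hcont).symm.trans ?_
    rw [h1]
    exact Lp.coeFn_zero _ _ _
  have heq := Measure.eqOn_open_of_ae_eq hae Ω.isOpen hcont.continuousOn continuousOn_const
  obtain ⟨x₀, hx₀⟩ := hne
  have han : AnalyticOnNhd ℝ (fun x ↦ ∑ p ∈ S, c p * F.eigenfun s (κ p) x) Set.univ :=
    Finset.analyticOnNhd_fun_sum _ fun p _ ↦
      analyticOnNhd_const.mul (F.analyticOnNhd_eigenfun s (κ p))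
  exact congrFun (han.eq_of_eventuallyEq (analyticOnNhd_const (v := (0 : ℝ)))
    (heq.eventuallyEq_of_mem (Ω.isOpen.mem_nhds hx₀))) x

/-- Expanded in characters, a relation involves disjoint orbits by `hκ`. The coefficient at `κ q` is
`c q` times the sum of the signs over the stabilizer of `κ q`, which `hstab` makes nonzero. -/
theorem linearIndependent_eigenvec (hΩ : Bornology.IsBounded (Ω : Set Plane))
    (hne : (Ω : Set Plane).Nonempty) {s : ℝ} {ι : Type*} {κ : ι → ℤ × ℤ}
    (hκ : ∀ p q g, hexAct g (κ p) = κ q → p = q)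
    (hstab : ∀ p, ∑ g, (if hexAct g (κ p) = κ p then hexSign s g else 0) ≠ 0) :
    LinearIndependent ℝ fun p ↦ F.eigenvec hΩ s (κ p) := by
  rw [linearIndependent_iff']
  intro S c h q hq
  have hx := F.eigenfun_sum_eq_zero hΩ hne h
  set L : ℤ × ℤ →₀ ℂ :=
    ∑ p ∈ S, ∑ g, Finsupp.single (hexAct g (κ p)) ((c p : ℂ) * hexSign s g) with hL
  have hL0 : L = 0 := by
    refine linearIndependent_iff.1 linearIndependent_planeChar L (funext fun z ↦ ?_)
    obtain ⟨x, hx1, hx2⟩ := F.exists_coord_eq z.toAdd.1 z.toAdd.2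
    have hz : z = Multiplicative.ofAdd (F.fstCoord x, F.sndCoord x) := by
      rw [hx1, hx2]
      rfl
    have := congrArg Complex.ofReal (hx x)
    push_cast at this
    simp only [← sum_hexSign_planeChar, ← hz] at this
    simp only [hL, map_sum, Finsupp.linearCombination_single, Finset.sum_apply, Pi.smul_apply,
      smul_eq_mul, mul_assoc, ← Finset.mul_sum]
    exact this
  have hLq : ((c q * ∑ g, (if hexAct g (κ q) = κ q then hexSign s g else 0) : ℝ) : ℂ) = L (κ q) := by
    rw [hL, Finsupp.finsetSum_apply, Finset.sum_eq_single q]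
    · rw [Finsupp.finsetSum_apply, Complex.ofReal_mul, Complex.ofReal_sum, Finset.mul_sum]
      refine Finset.sum_congr rfl fun g _ ↦ ?_
      rw [Finsupp.single_apply]
      split_ifs <;> simp
    · intro p _ hp
      rw [Finsupp.finsetSum_apply]
      exact Finset.sum_eq_zero fun g _ ↦ by
        rw [Finsupp.single_apply, if_neg fun h ↦ hp (hκ p q g h)]
    · exact fun h ↦ absurd hq h
  rw [hL0, Finsupp.zero_apply, Complex.ofReal_eq_zero] at hLq
  exact (mul_eq_zero.1 hLq).resolve_right (hstab q)

theorem eigenvec_congr (hΩ : Bornology.IsBounded (Ω : Set Plane)) {s : ℝ} {k l : ℤ × ℤ} {c : ℝ}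
    (h : ∀ x, F.eigenfun s k x = c * F.eigenfun s l x) :
    F.eigenvec hΩ s k = c • F.eigenvec hΩ s l := by
  refine Lp.ext ((coeFn_contToL2 hΩ _).trans ?_)
  filter_upwards [Lp.coeFn_smul c (F.eigenvec hΩ s l),
    coeFn_contToL2 hΩ (F.eigenfun_contDiff s l).continuous] with x h1 h2
  rw [h1, Pi.smul_apply, eigenvec, h2, smul_eq_mul, h]

theorem eigenvec_hexAct (hΩ : Bornology.IsBounded (Ω : Set Plane)) {s : ℝ} (hs : s * s = 1)
    (g : Fin 12) (k : ℤ × ℤ) :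
    F.eigenvec hΩ s (hexAct g k) = hexSign s g • F.eigenvec hΩ s k :=
  F.eigenvec_congr hΩ (F.eigenfun_hexAct hs g k)

theorem inner_eigenvec_eq_zero_of_hexAct (hΩ : Bornology.IsBounded (Ω : Set Plane)) {s : ℝ}
    (hs : s * s = 1) {u : L2 Ω} {g : Fin 12} {k : ℤ × ℤ}
    (h : inner ℝ u (F.eigenvec hΩ s (hexAct g k)) = 0) : inner ℝ u (F.eigenvec hΩ s k) = 0 := by
  rw [F.eigenvec_hexAct hΩ hs, real_inner_smul_right] at h
  refine (mul_eq_zero.1 h).resolve_left fun h0 ↦ ?_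
  have := abs_hexSign hs g
  rw [h0, abs_zero] at this
  exact zero_ne_one this

theorem finite_freq_fiber (d : ℕ) (lam : ℝ) : {p | F.freq (chamberPoint d p) = lam}.Finite := by
  have hs := F.size_pos
  set c := 16 * Real.pi ^ 2 / (9 * F.size ^ 2) with hc
  have hc0 : 0 < c := by have := Real.pi_pos; positivity
  obtain ⟨N, hN⟩ := exists_nat_ge (lam / c)
  refine ((Set.finite_Iic N).prod (Set.finite_Iic N)).subset fun p hp ↦ ?_
  have h1 : c * (hexForm (chamberPoint d p) : ℝ) = lam := hp
  have h2 : (hexForm (chamberPoint d p) : ℝ) ≤ N := by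
    rw [← h1, mul_div_cancel_left₀ _ hc0.ne'] at hN
    exact hN
  have h3 : hexForm (chamberPoint d p) ≤ N := by exact_mod_cast h2
  -- In chamber coordinates all coefficients of the form are positive, so its value bounds each
  -- coordinate.
  have h4 : hexForm (chamberPoint d p) = ((p.1 + d : ℕ) : ℤ) ^ 2 +
      3 * (p.1 + d : ℕ) * (p.2 + d : ℕ) + 3 * ((p.2 + d : ℕ) : ℤ) ^ 2 := by
    simp only [hexForm, chamberPoint]
    push_cast
    ring
  rw [h4] at h3
  have h5 : (p.1 + d) ^ 2 + 3 * (p.1 + d) * (p.2 + d) + 3 * (p.2 + d) ^ 2 ≤ N := by exact_mod_cast h3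
  have h6 := Nat.le_self_pow two_ne_zero (p.1 + d)
  have h7 := Nat.le_self_pow two_ne_zero (p.2 + d)
  exact ⟨by simp only [Set.mem_Iic]; nlinarith [Nat.zero_le (3 * (p.1 + d) * (p.2 + d))],
    by simp only [Set.mem_Iic]; nlinarith [Nat.zero_le (3 * (p.1 + d) * (p.2 + d))]⟩

end HexFrame

/-! ### The Dirichlet and Neumann spectra of the triangle. -/

namespace HexFrame

variable (F : HexFrame) {Ω : Opens Plane}

theorem nonempty_of_side (hside : ∀ x, x ∈ Ω ↔ ∀ j, 0 < F.side j x) :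
    (Ω : Set Plane).Nonempty := by
  obtain ⟨x, h1, h2⟩ := F.exists_coord_eq (3 / 10) (1 / 10)
  refine ⟨x, (hside x).2 fun j ↦ ?_⟩
  rw [side_eq, h1, h2]
  fin_cases j <;> norm_num

/-- Common to both problems, with d = 1 for Dirichlet and d = 0 for Neumann: the multiplicity of an
eigenvalue is the number of chamber points of that frequency, so the heat trace is the chamber sum
grouped by frequency. -/
theorem hasSum_heatTerm {V : ℝ → Submodule ℝ (L2 Ω)} {e : ℕ × ℕ → L2 Ω} {d : ℕ}
    (he : ∀ p, e p ∈ V (F.freq (chamberPoint d p)))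
    (horth : ∀ lam mu, lam ≠ mu → ∀ u ∈ V lam, ∀ v ∈ V mu, inner ℝ u v = 0)
    (hcomp : ∀ u, (∀ p, inner ℝ u (e p) = 0) → u = 0) (hli : LinearIndependent ℝ e) :
    (∀ lam, FiniteDimensional ℝ (V lam)) ∧ ∀ t T, HasSum (fun p ↦ Real.exp
      (-(16 * Real.pi ^ 2 * t / (9 * F.size ^ 2)) * hexForm (chamberPoint d p))) T →
      HasSum (heatTerm V t) T := by
  have hfin := F.finite_freq_fiber d
  have hV := eigenspace_eq_span he horth hcomp hfin
  refine ⟨fun lam ↦ ?_, fun t T hT ↦ ?_⟩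
  · rw [hV lam]
    exact FiniteDimensional.span_of_finite ℝ ((hfin lam).image e)
  · have h := hasSum_card_fiber_mul_exp hfin (t := t) (T := T) (hT.congr_fun fun p ↦ by
      congr 1
      rw [freq]
      ring)
    refine h.congr_fun fun lam ↦ ?_
    rw [heatTerm, hV lam, finrank_span_fiber hli hfin]

theorem dirichlet_spectrum (hΩ : Bornology.IsBounded (Ω : Set Plane))
    (hside : ∀ x, x ∈ Ω ↔ ∀ j, 0 < F.side j x) :
    (∀ lam, FiniteDimensional ℝ (dirichletEigenspace Ω lam)) ∧
      ∀ t, 0 < t → HasSum (heatTerm (dirichletEigenspace Ω) t) (hexTrace (-1) F.size t) := by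
  have hlt (p : ℕ × ℕ) : (chamberPoint 1 p).2 < (chamberPoint 1 p).1 ∧
      (chamberPoint 1 p).1 < 2 * (chamberPoint 1 p).2 := by
    simp only [chamberPoint]
    omega
  obtain ⟨h1, h2⟩ := F.hasSum_heatTerm (V := dirichletEigenspace Ω)
    (fun p ↦ F.eigenvec_mem_dirichletEigenspace hΩ hside (chamberPoint 1 p))
    (fun _ _ hne _ hu _ hv ↦ inner_dirichletEigenspace hne hu hv)
    (fun u hu ↦ F.eq_zero_of_inner_eigenvec hΩ hside (-1) fun k ↦ by
      rcases exists_hexAct_mem_open k with ⟨g, p, hp⟩ | ⟨g, hg, hk⟩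
      · exact F.inner_eigenvec_eq_zero_of_hexAct hΩ (g := g) (by norm_num) (by rw [← hp]; exact hu p)
      -- A wave vector fixed by a reflection has an antisymmetrization equal to its own negative.
      · have h := F.eigenvec_hexAct hΩ (s := -1) (by norm_num) g k
        rw [hk, hg, neg_one_smul] at h
        have h' := congrArg (inner ℝ u) h
        rw [inner_neg_right] at h'
        linarith)
    (F.linearIndependent_eigenvec hΩ (F.nonempty_of_side hside)
      (fun p q g h ↦ chamberPoint_injective 1 (eq_of_hexAct_eq (hlt p).1.le (hlt p).2.le
        (hlt q).1.le (hlt q).2.le h))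
      (fun p ↦ by
        rw [Finset.sum_eq_single 0]
        · simp [hexAct, hexSign]
        · exact fun g _ hg ↦ if_neg fun h ↦ hg (eq_zero_of_hexAct_eq (hlt p).1 (hlt p).2 h)
        · simp))
  refine ⟨h1, fun t ht ↦ h2 t _ ?_⟩
  have hs := F.size_pos
  have := hasSum_chamberPoint_open (y := 16 * Real.pi ^ 2 * t / (9 * F.size ^ 2))
    (by have := Real.pi_pos; positivity)
  rwa [hexTrace, neg_one_mul, ← sub_eq_add_neg]

theorem neumann_spectrum (hΩ : Bornology.IsBounded (Ω : Set Plane))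
    (hside : ∀ x, x ∈ Ω ↔ ∀ j, 0 < F.side j x) :
    (∀ lam, FiniteDimensional ℝ (neumannEigenspace Ω lam)) ∧
      ∀ t, 0 < t → HasSum (heatTerm (neumannEigenspace Ω) t) (hexTrace 1 F.size t) := by
  have hle (p : ℕ × ℕ) : (chamberPoint 0 p).2 ≤ (chamberPoint 0 p).1 ∧
      (chamberPoint 0 p).1 ≤ 2 * (chamberPoint 0 p).2 := by
    simp only [chamberPoint]
    omega
  obtain ⟨h1, h2⟩ := F.hasSum_heatTerm (V := neumannEigenspace Ω)
    (fun p ↦ F.eigenvec_mem_neumannEigenspace hΩ hside (chamberPoint 0 p))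
    (fun _ _ hne _ hu _ hv ↦ inner_neumannEigenspace hne hu hv)
    (fun u hu ↦ F.eq_zero_of_inner_eigenvec hΩ hside 1 fun k ↦ by
      obtain ⟨g, p, hp⟩ := exists_hexAct_mem_closed k
      exact F.inner_eigenvec_eq_zero_of_hexAct hΩ (g := g) (by norm_num) (by rw [← hp]; exact hu p))
    (F.linearIndependent_eigenvec hΩ (F.nonempty_of_side hside)
      (fun p q g h ↦ chamberPoint_injective 0 (eq_of_hexAct_eq (hle p).1 (hle p).2
        (hle q).1 (hle q).2 h))
      (fun p ↦ by
        -- Stabilizers on the chamber walls are nontrivial, but for s = 1 nothing cancels and the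
        -- identity contributes 1.
        refine (Finset.sum_pos' (fun g _ ↦ ?_) ⟨0, Finset.mem_univ 0, ?_⟩).ne'
        · simp only [hexSign]
          split_ifs <;> norm_num
        · simp [hexAct, hexSign]))
  refine ⟨h1, fun t ht ↦ h2 t _ ?_⟩
  have hs := F.size_pos
  have := hasSum_chamberPoint_closed (y := 16 * Real.pi ^ 2 * t / (9 * F.size ^ 2))
    (by have := Real.pi_pos; positivity)
  rwa [hexTrace, one_mul]

end HexFrame

/-! ### Geometry of the triangle -/

/-- The inner product of B - A and C - A is ℓ|C - A|/2 by the angle at A and |C - A|² by the right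
angle at C, so the short leg is ℓ/2. -/
theorem triangle_metric {ℓ : ℝ} {A B C : Plane} (hA : ∠ B A C = Real.pi / 3)
    (hC : ∠ A C B = Real.pi / 2) (hAB : dist A B = ℓ) :
    inner ℝ (A - C) (A - C) = ℓ ^ 2 / 4 ∧ inner ℝ (C - B) (C - B) = 3 * ℓ ^ 2 / 4 ∧
      inner ℝ (A - C) (C - B) = 0 := by
  have h0 : inner ℝ (A - C) (C - B) = 0 := by
    have := InnerProductGeometry.inner_eq_zero_iff_angle_eq_pi_div_two (A - C) (B - C) |>.2 hC
    rw [← neg_sub B C, inner_neg_right, this, neg_zero]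
  have hBA : ‖B - A‖ = ℓ := by rw [← dist_eq_norm, dist_comm, hAB]
  have h1 : inner ℝ (B - A) (C - A) = ℓ * ‖C - A‖ / 2 := by
    have h := InnerProductGeometry.cos_angle_mul_norm_mul_norm (B - A) (C - A)
    have hA' : InnerProductGeometry.angle (B - A) (C - A) = Real.pi / 3 := hA
    rw [hA', Real.cos_pi_div_three, hBA] at h
    linarith
  have e1 : inner ℝ (B - A) (C - A) = ‖C - A‖ ^ 2 := by
    have : B - A = (C - A) - (C - B) := by abel
    rw [this, inner_sub_left, real_inner_self_eq_norm_sq, ← neg_sub A C, inner_neg_right,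
      real_inner_comm, h0]
    ring
  have hne : ‖C - A‖ ≠ 0 := by
    intro h
    have : C - A = 0 := norm_eq_zero.1 h
    have hA' : InnerProductGeometry.angle (B - A) (C - A) = Real.pi / 3 := hA
    rw [this, InnerProductGeometry.angle_zero_right] at hA'
    linarith [Real.pi_pos]
  have h2 : ‖C - A‖ = ℓ / 2 := by
    have : ‖C - A‖ * (‖C - A‖ - ℓ / 2) = 0 := by rw [e1] at h1; linarith
    linarith [(mul_eq_zero.1 this).resolve_left hne]
  have h3 : inner ℝ (A - C) (A - C) = ℓ ^ 2 / 4 := by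
    rw [real_inner_self_eq_norm_sq, norm_sub_rev, h2]
    ring
  refine ⟨h3, ?_, h0⟩
  have h4 : inner ℝ (B - A) (B - A) = ℓ ^ 2 := by rw [real_inner_self_eq_norm_sq, hBA]
  have : B - A = -((A - C) + (C - B)) := by abel
  rw [this, inner_neg_neg, inner_add_left, inner_add_right, inner_add_right, h3, h0,
    real_inner_comm, h0] at h4
  linarith

/-- For collinear points the angle at A is 0 or π, or the default π/2 if A coincides with B or C. -/
theorem affineIndependent_of_angle {A B C : Plane} (hA : ∠ B A C = Real.pi / 3) :
    AffineIndependent ℝ ![A, B, C] := by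
  rw [affineIndependent_iff_not_collinear_set]
  intro h
  have hpi := Real.pi_pos
  have h' : Collinear ℝ {B, A, C} := by rwa [Set.insert_comm]
  rcases collinear_iff_eq_or_eq_or_angle_eq_zero_or_angle_eq_pi.1 h' with h | h | h | h
  · rw [h, EuclideanGeometry.angle_self_left] at hA
    linarith
  · rw [h, EuclideanGeometry.angle_self_right] at hA
    linarith
  · linarith
  · linarith

theorem exists_hexFrame {ℓ : ℝ} (hℓ : 0 < ℓ) {A B C : Plane} (hA : ∠ B A C = Real.pi / 3)
    (hC : ∠ A C B = Real.pi / 2) (hAB : dist A B = ℓ) :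
    ∃ F : HexFrame, F.size = ℓ ∧ ∀ x, x ∈ openTriangle A B C ↔ ∀ j, 0 < F.side j x := by
  obtain ⟨hQ, hP, hPQ⟩ := triangle_metric hA hC hAB
  have hQP : inner ℝ (C - B) (A - C) = 0 := (real_inner_comm _ _).trans hPQ
  -- The frame gives B, C, A the coordinates (0, 0), (1/2, 0), (1/3, 1/3). The three side functions
  -- are then positive multiples of the barycentric coordinates at A, C, B, in this order.
  let F : HexFrame :=
    { origin := B
      va := (2 / (3 * ℓ ^ 2)) • ((C - B) - (A - C))
      vb := (4 / (3 * ℓ ^ 2)) • (A - C)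
      size := ℓ
      size_pos := hℓ
      inner_va_va := by
        simp only [real_inner_smul_left, real_inner_smul_right, inner_sub_left (C - B),
          inner_sub_right _ (C - B) (A - C), hP, hQ, hPQ, hQP]
        field_simp
        ring
      inner_vb_vb := by
        simp only [real_inner_smul_left, real_inner_smul_right, hQ]
        field_simp
        norm_num
      inner_va_vb := by
        simp only [real_inner_smul_left, real_inner_smul_right, inner_sub_left (C - B), hQ, hQP]
        field_simp
        ring }
  refine ⟨F, rfl, fun x ↦ ?_⟩
  have hind := affineIndependent_of_angle hA
  let b : AffineBasis (Fin 3) ℝ Plane := ⟨![A, B, C], hind, by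
    rw [hind.affineSpan_eq_top_iff_card_eq_finrank_add_one]
    simp⟩
  have hb : ∀ i, b i = ![A, B, C] i := fun _ ↦ rfl
  have hrange : Set.range b = {A, B, C} := by
    have : Set.range ![A, B, C] = {A, B, C} := by
      simp only [Matrix.range_cons, Matrix.range_empty, Set.union_empty, Set.singleton_union]
    exact this
  have hmem : x ∈ openTriangle A B C ↔ ∀ i, 0 < b.coord i x := by
    have h := b.interior_convexHull
    rw [hrange] at h
    change x ∈ interior (convexHull ℝ {A, B, C}) ↔ _
    rw [h]
    rfl
  have hx := b.linear_combination_coord_eq_self x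
  have h1 := b.sum_coord_apply_eq_one x
  rw [Fin.sum_univ_three] at hx h1
  simp only [hb, Matrix.cons_val] at hx
  set r := b.coord 0 x
  set s := b.coord 1 x
  set t := b.coord 2 x
  have hxB : x - B = r • (A - C) + (r + t) • (C - B) := by
    have hs : s = 1 - r - t := by linarith
    rw [← hx, hs]
    module
  have e1 : F.fstCoord x = r / 3 + t / 2 := by
    change inner ℝ ((2 / (3 * ℓ ^ 2)) • ((C - B) - (A - C))) (x - B) = _
    rw [hxB]
    simp only [real_inner_smul_left, real_inner_smul_right, inner_sub_left (C - B),
          inner_add_right, hP, hQ, hPQ, hQP]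
    field_simp
    ring
  have e2 : F.sndCoord x = r / 3 := by
    change inner ℝ ((4 / (3 * ℓ ^ 2)) • (A - C)) (x - B) = _
    rw [hxB]
    simp only [real_inner_smul_left, real_inner_smul_right, inner_add_right, hQ, hPQ]
    field_simp
    ring
  rw [hmem, Fin.forall_fin_succ, Fin.forall_fin_two, Fin.forall_fin_succ, Fin.forall_fin_two]
  simp only [HexFrame.side_eq, e1, e2]
  change (0 < r ∧ 0 < s ∧ 0 < t) ↔ (0 < r / 3 ∧ 0 < r / 3 + t / 2 - r / 3 ∧
    0 < 1 - 2 * (r / 3 + t / 2) - r / 3)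
  constructor
  · rintro ⟨h1, h2, h3⟩
    refine ⟨?_, ?_, ?_⟩ <;> linarith
  · rintro ⟨h1, h2, h3⟩
    refine ⟨?_, ?_, ?_⟩ <;> linarith

theorem isBounded_openTriangle (A B C : Plane) :
    Bornology.IsBounded (openTriangle A B C : Set Plane) :=
  (isBounded_convexHull.2 (Set.toFinite {A, B, C}).isBounded).subset interior_subset

theorem isSharpRemainder_congr {R R' : ℝ → ℝ} {c : ℝ} (h : R =ᶠ[𝓝[>] 0] R')
    (hR : IsSharpRemainder R c) : IsSharpRemainder R' c := by
  obtain ⟨h1, h2, h3⟩ := hR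
  refine ⟨h.symm.trans_isBigO h1, h2.trans_eventuallyEq h, ?_⟩
  convert h3 using 4
  exact isBigO_congr h.symm EventuallyEq.rfl

theorem mainTheorem4 (ℓ : ℝ) (hℓ : 0 < ℓ) (A B C : Plane)
    (hA : ∠ B A C = Real.pi / 3) (hB : ∠ A B C = Real.pi / 6) (hC : ∠ A C B = Real.pi / 2)
    (hAB : dist A B = ℓ) :
    ((∀ lam : ℝ, FiniteDimensional ℝ (dirichletEigenspace (openTriangle A B C) lam)) ∧
      (∀ t : ℝ, 0 < t → Summable (heatTerm (dirichletEigenspace (openTriangle A B C)) t)) ∧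
      IsSharpRemainder
        (fun t ↦ dirichletHeatTrace (openTriangle A B C) t -
          (ℓ ^ 2 * √3 / (32 * Real.pi * t) - ℓ * (3 + √3) / (16 * √(Real.pi * t)) + 5 / 12
            - ℓ / 8 * √(3 / (Real.pi * t)) * Real.exp (-(3 * ℓ ^ 2) / (16 * t))
            - 3 * ℓ / (8 * √(Real.pi * t)) * Real.exp (-(9 * ℓ ^ 2) / (16 * t))))
        (3 * ℓ ^ 2 / 4)) ∧
    ((∀ lam : ℝ, FiniteDimensional ℝ (neumannEigenspace (openTriangle A B C) lam)) ∧
      (∀ t : ℝ, 0 < t → Summable (heatTerm (neumannEigenspace (openTriangle A B C)) t)) ∧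
      IsSharpRemainder
        (fun t ↦ neumannHeatTrace (openTriangle A B C) t -
          (ℓ ^ 2 * √3 / (32 * Real.pi * t) + ℓ * (3 + √3) / (16 * √(Real.pi * t)) + 5 / 12
            + ℓ / 8 * √(3 / (Real.pi * t)) * Real.exp (-(3 * ℓ ^ 2) / (16 * t))
            + 3 * ℓ / (8 * √(Real.pi * t)) * Real.exp (-(9 * ℓ ^ 2) / (16 * t))))
        (3 * ℓ ^ 2 / 4)) := by
  obtain ⟨F, rfl, hside⟩ := exists_hexFrame hℓ hA hC hAB
  have hΩ := isBounded_openTriangle A B C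
  obtain ⟨d1, d2⟩ := F.dirichlet_spectrum hΩ hside
  obtain ⟨n1, n2⟩ := F.neumann_spectrum hΩ hside
  refine ⟨⟨d1, fun t ht ↦ (d2 t ht).summable, ?_⟩, ⟨n1, fun t ht ↦ (n2 t ht).summable, ?_⟩⟩
  · refine isSharpRemainder_congr ?_ (isSharpRemainder_hexTrace (s := -1) hℓ)
    filter_upwards [self_mem_nhdsWithin] with t ht
    rw [dirichletHeatTrace, (d2 t ht).tsum_eq]
    ring
  · refine isSharpRemainder_congr ?_ (isSharpRemainder_hexTrace (s := 1) hℓ)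
    filter_upwards [self_mem_nhdsWithin] with t ht
    rw [neumannHeatTrace, (n2 t ht).tsum_eq]
    ring
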